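/- **Model.** A *Nested Dataflow (ND) program* is a finite list of recursive procedures with natural-number parameters, working on a shared memory of real-valued cells. Its basic steps are skips, procedure calls, tests (comparing two indices or two reals) and assignments of a real expression to a cell; expressions use memory cells, values $w(i,j)$, integer constants, $+,-,\cdot,\min,\max$. Tasks are composed by serial composition $a;b$ (full dependency), parallel composition $a\parallel b$ (no dependency), or a typed fire construct $a\leadsto b$ (partial dependency), the latter being refined recursively by the finitely many fire rules of its type (each of which replaces it by a dependency between prescribed subtasks of $a$ and $b$) until both tasks are base cases (tasks without parallel construct, or tasks marked as kernels), where it becomes a full dependency. An execution unfolds a spawn tree, whose leaves (basic steps) are the vertices of a DAG; the edges are these dependencies. Every arithmetic operation, comparison, memory access, evaluation of $w$ and control step costs one unit, and evaluating $w$ accesses no memory. *Work* $T_1$ is the total cost of all vertices; *time* $T_\infty$ is the largest total cost along a directed path; *space* is the least $S$ such that all accessed cells lie in $\{0,\dots,S-1\}$; the *cache complexity* $Q_1$ is the number of misses of the serial left-to-right execution in the ideal cache model (optimal replacement, initially empty cache of $M$ cells, lines of $B$ cells). Executions must be race-free: a vertex writing a cell is ordered by the DAG relative to every other vertex accessing that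 cell. **Theorem.** There is one ND program $P$, independent of $n,w,M,B$, such that for every $n\ge 0$, every $w:\mathbb N\times\mathbb N\to\mathbb R$ and every $D[0]\in\mathbb R$ (given in cell $0$, the other cells being arbitrary), $P$ on input $n$ terminates, is race-free, and computes in cells $0,\dots,n$ the solution of the 1D (least-weight-subsequence) recurrence $$D[j]=\min_{0\le i<j}\bigl(D[i]+w(i,j)\bigr)\qquad(1\le j\le n),$$ and moreover: 1. There is a constant $C$ such that for all $n\ge2$ and all inputs, $T_\infty\le C\sqrt n\,\log n$, $T_1\le Cn^2$, and the space is at most $Cn^2$. 2. For every $\tau>0$ there is a constant $C_\tau$ such that for all $n\ge 2$, all $M\ge B\ge1$ with $M\ge\tau B^2$ (tall cache), and all inputs, $Q_1\le C_\tau\,(n^2/B+1)$. 3. The work is optimal: there is a constant $c>0$ such that for every ND program $P'$ and every $n$, if $P'$ computes the solution of the recurrence of size $n$ for all inputs (by its serial execution), then its work on every input of size $n$ is at least $cn^2$. -/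

import Mathlib

namespace NestedDataflow

/-! ### Programs

Real data live in a shared memory with cells `0, 1, 2, …`; natural numbers (indices, sizes) are
passed as procedure parameters.  A program is a finite text. -/

/-- Index expressions over the parameters of the current procedure. -/
inductive IExp where
  | var (i : ℕ)
  | lit (k : ℕ)
  | add (a b : IExp)
  | sub (a b : IExp)
  | mul (a b : IExp)
  | div (a b : IExp)
  | mod (a b : IExp)

/-- Value of an index expression (truncated subtraction, division with remainder). -/
def IExp.eval (env : List ℕ) : IExp → ℕ
  | var i => env.getD i 0
  | lit k => k
  | add a b => a.eval env + b.eval env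
  | sub a b => a.eval env - b.eval env
  | mul a b => a.eval env * b.eval env
  | div a b => a.eval env / b.eval env
  | mod a b => a.eval env % b.eval env

/-- Every node of an index expression costs one unit. -/
def IExp.cost : IExp → ℕ
  | var _ => 1
  | lit _ => 1
  | add a b => a.cost + b.cost + 1
  | sub a b => a.cost + b.cost + 1
  | mul a b => a.cost + b.cost + 1
  | div a b => a.cost + b.cost + 1
  | mod a b => a.cost + b.cost + 1

/-- Real expressions: memory cells, values `w(i, j)` of the weight function, arithmetic. -/
inductive RExp where
  | lit (z : ℤ)
  | mem (a : IExp)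
  | weight (i j : IExp)
  | add (x y : RExp)
  | sub (x y : RExp)
  | mul (x y : RExp)
  | min (x y : RExp)
  | max (x y : RExp)

/-- Value of a real expression for weight function `w` and memory contents `m`. -/
noncomputable def RExp.eval (w : ℕ → ℕ → ℝ) (env : List ℕ) (m : ℕ → ℝ) : RExp → ℝ
  | lit z => (z : ℝ)
  | mem a => m (a.eval env)
  | weight i j => w (i.eval env) (j.eval env)
  | add x y => x.eval w env m + y.eval w env m
  | sub x y => x.eval w env m - y.eval w env m
  | mul x y => x.eval w env m * y.eval w env m
  | min x y => Min.min (x.eval w env m) (y.eval w env m)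
  | max x y => Max.max (x.eval w env m) (y.eval w env m)

/-- The memory cells read by an expression, in order.  Evaluating `w` needs no memory access. -/
def RExp.reads (env : List ℕ) : RExp → List ℕ
  | lit _ => []
  | mem a => [a.eval env]
  | weight _ _ => []
  | add x y => x.reads env ++ y.reads env
  | sub x y => x.reads env ++ y.reads env
  | mul x y => x.reads env ++ y.reads env
  | min x y => x.reads env ++ y.reads env
  | max x y => x.reads env ++ y.reads env

/-- Every arithmetic operation, comparison, memory access and evaluation of `w` costs one unit. -/
def RExp.cost : RExp → ℕ
  | lit _ => 1
  | mem a => a.cost + 1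
  | weight i j => i.cost + j.cost + 1
  | add x y => x.cost + y.cost + 1
  | sub x y => x.cost + y.cost + 1
  | mul x y => x.cost + y.cost + 1
  | min x y => x.cost + y.cost + 1
  | max x y => x.cost + y.cost + 1

/-- Tests: comparison of two indices or of two reals. -/
inductive Test where
  | ile (a b : IExp)
  | rle (x y : RExp)

def Test.Holds (w : ℕ → ℕ → ℝ) (env : List ℕ) (m : ℕ → ℝ) : Test → Prop
  | ile a b => a.eval env ≤ b.eval env
  | rle x y => x.eval w env m ≤ y.eval w env m

def Test.reads (env : List ℕ) : Test → List ℕ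
  | ile _ _ => []
  | rle x y => x.reads env ++ y.reads env

def Test.cost : Test → ℕ
  | ile a b => a.cost + b.cost + 1
  | rle x y => x.cost + y.cost + 1

/-- The three ways to compose two tasks: full dependency (`;`), no dependency (`∥`), and partial
dependency (the fire construct, of a given type). -/
inductive Comp where
  | seq
  | par
  | fire (type : ℕ)

/-- Statements.  `kernel s` behaves as `s`, but is treated as a base case by the fire rules. -/
inductive Stmt where
  | skip
  | store (a : IExp) (x : RExp)
  | comp (k : Comp) (s₁ s₂ : Stmt)
  | ite (c : Test) (s₁ s₂ : Stmt)
  | call (f : ℕ) (args : List IExp)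
  | kernel (s : Stmt)

/-- A fire rule: a partial dependency from source to sink is refined into the dependency `kind`
from the subtask of the source at `src` to the subtask of the sink at `dst`
(`false` is the first, `true` the second component of a composition). -/
structure FireRule where
  src : List Bool
  kind : Comp
  dst : List Bool

/-- A Nested Dataflow program: procedures (number `0` is the main one), and for each fire type the
set of its fire rules. -/
structure Program where
  procs : List Stmt
  rules : List (List FireRule)

/-! ### Spawn trees and serial execution -/

/-- A vertex of the computation DAG: its memory accesses (reads, then writes) and its cost. -/
structure Step where
  reads : List ℕ
  writes : List ℕ
  cost : ℕ

/-- The spawn tree unfolded by an execution. -/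
inductive SpawnTree where
  | leaf (s : Step)
  | node (k : Comp) (l r : SpawnTree)
  | kernel (t : SpawnTree)

/-- `Exec P w s env m t m'`: the serial (left to right) execution of `s` with parameters `env` from
memory `m` terminates with memory `m'` and unfolds the spawn tree `t`.  Tests and calls are
vertices that precede the task they start. -/
inductive Exec (P : Program) (w : ℕ → ℕ → ℝ) :
    Stmt → List ℕ → (ℕ → ℝ) → SpawnTree → (ℕ → ℝ) → Prop where
  | skip (env : List ℕ) (m : ℕ → ℝ) : Exec P w Stmt.skip env m (SpawnTree.leaf ⟨[], [], 1⟩) m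
  | store (a : IExp) (x : RExp) (env : List ℕ) (m : ℕ → ℝ) :
      Exec P w (Stmt.store a x) env m
        (SpawnTree.leaf ⟨x.reads env, [a.eval env], a.cost + x.cost + 1⟩)
        (Function.update m (a.eval env) (x.eval w env m))
  | comp (k : Comp) {s₁ s₂ : Stmt} {env : List ℕ} {m m₁ m₂ : ℕ → ℝ} {t₁ t₂ : SpawnTree} :
      Exec P w s₁ env m t₁ m₁ → Exec P w s₂ env m₁ t₂ m₂ →
      Exec P w (Stmt.comp k s₁ s₂) env m (SpawnTree.node k t₁ t₂) m₂
  | iteTrue {c : Test} {s₁ : Stmt} (s₂ : Stmt) {env : List ℕ} {m m' : ℕ → ℝ} {t : SpawnTree} :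
      c.Holds w env m → Exec P w s₁ env m t m' →
      Exec P w (Stmt.ite c s₁ s₂) env m
        (SpawnTree.node Comp.seq (SpawnTree.leaf ⟨c.reads env, [], c.cost + 1⟩) t) m'
  | iteFalse {c : Test} (s₁ : Stmt) {s₂ : Stmt} {env : List ℕ} {m m' : ℕ → ℝ} {t : SpawnTree} :
      ¬ c.Holds w env m → Exec P w s₂ env m t m' →
      Exec P w (Stmt.ite c s₁ s₂) env m
        (SpawnTree.node Comp.seq (SpawnTree.leaf ⟨c.reads env, [], c.cost + 1⟩) t) m'
  | call {f : ℕ} {args : List IExp} {body : Stmt} {env : List ℕ} {m m' : ℕ → ℝ} {t : SpawnTree} :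
      P.procs[f]? = some body → Exec P w body (args.map (IExp.eval env)) m t m' →
      Exec P w (Stmt.call f args) env m
        (SpawnTree.node Comp.seq (SpawnTree.leaf ⟨[], [], (args.map IExp.cost).sum + 1⟩) t) m'
  | kernel {s : Stmt} {env : List ℕ} {m m' : ℕ → ℝ} {t : SpawnTree} :
      Exec P w s env m t m' → Exec P w (Stmt.kernel s) env m (SpawnTree.kernel t) m'

/-- A run of the program on problem size `n`. -/
def Program.Run (P : Program) (w : ℕ → ℕ → ℝ) (n : ℕ) (m : ℕ → ℝ) (t : SpawnTree) (m' : ℕ → ℝ) : Prop :=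
  Exec P w (Stmt.call 0 [IExp.lit n]) [] m t m'

/-! ### The computation DAG -/

/-- The DAG vertex at a position of the spawn tree, if the position is that of a leaf. -/
def SpawnTree.step? : SpawnTree → List Bool → Option Step
  | leaf s, [] => some s
  | leaf _, _ :: _ => none
  | node _ _ _, [] => none
  | node _ l _, false :: p => l.step? p
  | node _ _ r, true :: p => r.step? p
  | kernel t, p => t.step? p

/-- Tasks at which refinement stops: those without parallel construct, and kernels. -/
def SpawnTree.isBase : SpawnTree → Bool
  | leaf _ => true
  | node Comp.seq l r => l.isBase && r.isBase
  | node _ _ _ => false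
  | kernel _ => true

/-- The subtask at a position; the descent stops at a base task.  The first component is the
position actually reached. -/
def SpawnTree.descend : SpawnTree → List Bool → List Bool × SpawnTree
  | t, [] => ([], t)
  | leaf s, _ :: _ => ([], leaf s)
  | kernel t, _ :: _ => ([], kernel t)
  | node k l r, b :: p =>
      if (node k l r).isBase then ([], node k l r)
      else match b with
        | false => (false :: (l.descend p).1, (l.descend p).2)
        | true => (true :: (r.descend p).1, (r.descend p).2)

/-- `Arrow R k a b p q`: a dependency of kind `k` of task `b` on task `a` makes the vertex of `b` at
`q` depend on the vertex of `a` at `p`.  A partial dependency is a full one between base tasks, and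
is otherwise refined by the fire rules `R` of its type. -/
inductive Arrow (R : List (List FireRule)) :
    Comp → SpawnTree → SpawnTree → List Bool → List Bool → Prop where
  | seq {a b : SpawnTree} {p q : List Bool} :
      (a.step? p).isSome → (b.step? q).isSome → Arrow R Comp.seq a b p q
  | base {type : ℕ} {a b : SpawnTree} {p q : List Bool} :
      a.isBase → b.isBase → (a.step? p).isSome → (b.step? q).isSome →
      Arrow R (Comp.fire type) a b p q
  | refine {type : ℕ} {a b : SpawnTree} {p q : List Bool} {ρ : FireRule} :
      ¬ (a.isBase ∧ b.isBase) → ρ ∈ R.getD type [] →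
      Arrow R ρ.kind (a.descend ρ.src).2 (b.descend ρ.dst).2 p q →
      Arrow R (Comp.fire type) a b ((a.descend ρ.src).1 ++ p) ((b.descend ρ.dst).1 ++ q)

/-- The edges of the computation DAG, between positions of leaves. -/
def SpawnTree.Edge (R : List (List FireRule)) : SpawnTree → List Bool → List Bool → Prop
  | leaf _, _, _ => False
  | node _ l _, false :: p, false :: q => l.Edge R p q
  | node _ _ r, true :: p, true :: q => r.Edge R p q
  | node k l r, false :: p, true :: q => Arrow R k l r p q
  | node _ _ _, _, _ => False
  | kernel t, p, q => t.Edge R p q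

/-- No determinacy race: a vertex that writes a cell is ordered by the DAG with respect to every
other vertex that accesses this cell (concurrent reads are allowed, writes are exclusive). -/
def SpawnTree.RaceFree (R : List (List FireRule)) (t : SpawnTree) : Prop :=
  ∀ (p q : List Bool) (s s' : Step), p ≠ q → t.step? p = some s → t.step? q = some s' →
    ∀ x ∈ s.writes, x ∈ s'.reads ++ s'.writes →
      Relation.TransGen (t.Edge R) p q ∨ Relation.TransGen (t.Edge R) q p

/-! ### Complexity measures -/

/-- Work `T₁`: total cost of all vertices. -/
def SpawnTree.work : SpawnTree → ℕ
  | leaf s => s.cost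
  | node _ l r => l.work + r.work
  | kernel t => t.work

/-- Cost of the vertex at a position. -/
def SpawnTree.costAt (t : SpawnTree) (p : List Bool) : ℕ := ((t.step? p).map Step.cost).getD 0

/-- Time `T_∞` is at most `T`: every directed path of the DAG has total cost at most `T`. -/
def SpawnTree.TimeLE (R : List (List FireRule)) (t : SpawnTree) (T : ℝ) : Prop :=
  ∀ path : List (List Bool), path.IsChain (t.Edge R) → (((path.map t.costAt).sum : ℕ) : ℝ) ≤ T

/-- The sequence of memory accesses of the serial execution. -/
def SpawnTree.trace : SpawnTree → List ℕ
  | leaf s => s.reads ++ s.writes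
  | node _ l r => l.trace ++ r.trace
  | kernel t => t.trace

/-- Space: the least `S` such that all accessed cells are among `0, …, S - 1`. -/
def SpawnTree.space (t : SpawnTree) : ℕ := (t.trace.map (· + 1)).foldr max 0

/-- `Serves k C ls q`: a cache of `k` lines with contents `C` can serve the requests `ls` for memory
lines, in order, with `q` misses, for a suitable choice of the evicted lines. -/
inductive Serves (k : ℕ) : Finset ℕ → List ℕ → ℕ → Prop where
  | nil (C : Finset ℕ) : Serves k C [] 0
  | hit {C : Finset ℕ} {x : ℕ} {ls : List ℕ} {q : ℕ} :
      x ∈ C → Serves k C ls q → Serves k C (x :: ls) q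
  | miss {C C' : Finset ℕ} {x : ℕ} {ls : List ℕ} {q : ℕ} :
      x ∉ C → C' ⊆ C → C'.card + 1 ≤ k → Serves k (insert x C') ls q →
      Serves k C (x :: ls) (q + 1)

/-- The serial cache complexity `Q₁` is at most `Q`, in the ideal cache model (optimal replacement,
initially empty cache) with a cache of `M` cells and cache lines of `B` cells. -/
def SpawnTree.CacheMissesLE (t : SpawnTree) (M B : ℕ) (Q : ℝ) : Prop :=
  ∃ q : ℕ, Serves (M / B) ∅ (t.trace.map (· / B)) q ∧ (q : ℝ) ≤ Q

/-! ### The 1D problem -/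

/-- `D[0] = d₀` and `D[j] = min_{0 ≤ i < j} (D[i] + w(i, j))` for `1 ≤ j ≤ n`. -/
def Is1DSolution (n : ℕ) (w : ℕ → ℕ → ℝ) (d₀ : ℝ) (D : ℕ → ℝ) : Prop :=
  D 0 = d₀ ∧ ∀ j, 1 ≤ j → j ≤ n → IsLeast {x | ∃ i < j, x = D i + w i j} (D j)

/-- On size `n`, from `D[0]` in cell `0` and arbitrary contents of the other cells, the serial
execution always terminates with `D[0], …, D[n]` in the cells `0, …, n`. -/
def Program.Computes1D (P : Program) (n : ℕ) : Prop :=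
  ∀ (w : ℕ → ℕ → ℝ) (m : ℕ → ℝ), ∃ (t : SpawnTree) (m' : ℕ → ℝ),
    P.Run w n m t m' ∧ Is1DSolution n w (m 0) m'

/-- The program solves the 1D problem: it is correct on all sizes and all its executions are free of
races, so that every schedule that respects the DAG gives the result of the serial execution. -/
def Program.Solves1D (P : Program) : Prop :=
  ∀ n : ℕ, P.Computes1D n ∧
    ∀ (w : ℕ → ℕ → ℝ) (m : ℕ → ℝ) (t : SpawnTree) (m' : ℕ → ℝ), P.Run w n m t m' → t.RaceFree P.rules

end NestedDataflow

/-! Upper bounds. Regard `w i j` as the length of an edge from `i` to `j`, so that `D[j]` is `D[0]`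
plus the length of a shortest path from 0 to `j`. Cut the indices 1, ..., n into blocks of length s,
where s is about √n. For each `j`, the distances to `j` from the vertices of its own block do not
involve `D`. They are found by going down from `j`, each as a minimum over at most s terms. All rows
are treated in parallel, with work O(s²) per row, hence O(n²) in total. The blocks are then treated
serially. For a block starting at `a`, let `E[p]` be the minimum of `D[i] + w i p` over `i < a`. An
optimal path to `j` enters the block exactly once, so `D[j]` is the minimum of `E[p]` plus the
distance from `p` to `j` (`IsRow.isLeast`). Thus a block needs only two rounds of independent
minima. Every minimum is a tree reduction of depth O(log n); there are O(s) serial reductions in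
each row and O(s) blocks, so the time is O(√n log n). A private scratch row for each `j` makes
parallel tasks disjoint, at the price of quadratic space. Only serial and parallel composition are
used, so race-freeness is local and the time is bounded by a recursive span.

Cache. A reduction over l terms moves O(l + B) cells, because its subtrees of length at most B touch
at most six lines. Summing gives O(n² + nB) cells, which suffices when B = O(n). For larger B the
tall cache holds the whole memory. If B is bounded in terms of τ, counting every access as a miss is
enough.

Lower bound. A value `w i j` with `i < j ≤ n` that is never evaluated could be lowered without
changing the run, which would falsify the answer. Hence all n(n+1)/2 values are evaluated.

The facts about the concrete program are derived in a calculus of resource triples `Runs`. Its main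
rules are `Runs.dnc` and `Runs.reduce`. -/

namespace NestedDataflow

/-! ### Time -/

/-- Longest path when every partial dependency is treated as a full one. -/
def SpawnTree.span : SpawnTree → ℕ
  | leaf s => s.cost
  | node Comp.par l r => max l.span r.span
  | node _ l r => l.span + r.span
  | kernel t => t.span

/-- No edge leads from the right subtree back to the left one, so a path that has entered the right
subtree stays there. -/
theorem chain_node_true {R : List (List FireRule)} {k : Comp} {l r : SpawnTree}
    (rest : List (List Bool)) (q : List Bool)
    (h : ((true :: q) :: rest).IsChain ((SpawnTree.node k l r).Edge R)) :
    ∃ p₂, rest = p₂.map (true :: ·) ∧ (q :: p₂).IsChain (r.Edge R) := by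
  induction rest generalizing q with
  | nil => exact ⟨[], rfl, by simp⟩
  | cons x rest ih =>
    rw [List.isChain_cons_cons] at h
    obtain ⟨h1, h2⟩ := h
    rcases x with _ | ⟨_ | _, q'⟩
    · simp [SpawnTree.Edge] at h1
    · simp [SpawnTree.Edge] at h1
    · obtain ⟨p, rfl, hp⟩ := ih q' h2
      refine ⟨q' :: p, rfl, ?_⟩
      rw [List.isChain_cons_cons]
      exact ⟨by simpa [SpawnTree.Edge] using h1, hp⟩

theorem not_arrow_par {R : List (List FireRule)} {a b : SpawnTree} {p q : List Bool} :
    ¬ Arrow R Comp.par a b p q := by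
  intro h
  cases h

theorem chain_node_false {R : List (List FireRule)} {k : Comp} {l r : SpawnTree}
    (rest : List (List Bool)) (q : List Bool)
    (h : ((false :: q) :: rest).IsChain ((SpawnTree.node k l r).Edge R)) :
    ∃ p₁ p₂, rest = p₁.map (false :: ·) ++ p₂.map (true :: ·) ∧
      (q :: p₁).IsChain (l.Edge R) ∧ p₂.IsChain (r.Edge R) ∧ (k = Comp.par → p₂ = []) := by
  induction rest generalizing q with
  | nil => exact ⟨[], [], rfl, by simp, by simp, fun _ => rfl⟩
  | cons x rest ih =>
    rw [List.isChain_cons_cons] at h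
    obtain ⟨h1, h2⟩ := h
    rcases x with _ | ⟨_ | _, q'⟩
    · simp [SpawnTree.Edge] at h1
    · obtain ⟨p₁, p₂, rfl, hp, hp', hk⟩ := ih q' h2
      refine ⟨q' :: p₁, p₂, rfl, ?_, hp', hk⟩
      rw [List.isChain_cons_cons]
      exact ⟨by simpa [SpawnTree.Edge] using h1, hp⟩
    · obtain ⟨p, rfl, hp⟩ := chain_node_true rest q' h2
      refine ⟨[], q' :: p, rfl, by simp, hp, ?_⟩
      rintro rfl
      simp only [SpawnTree.Edge] at h1
      exact absurd h1 not_arrow_par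

/-- A path through a node is a path on the left followed by a path on the right. At a parallel node
nothing crosses, so only one of the two parts is present. This holds for arbitrary fire rules, since
a full dependency dominates any partial one. -/
theorem SpawnTree.sum_costAt_le_span (R : List (List FireRule)) (t : SpawnTree) :
    ∀ path : List (List Bool), path.IsChain (t.Edge R) → (path.map t.costAt).sum ≤ t.span := by
  induction t with
  | leaf s =>
    intro path h
    rcases path with _ | ⟨p, _ | ⟨q, rest⟩⟩
    · simp
    · rcases p with _ | ⟨b, p⟩ <;> simp [costAt, step?, span]
    · rw [List.isChain_cons_cons] at h
      exact absurd h.1 (by simp [Edge])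
  | kernel t ih =>
    intro path h
    have e1 : (SpawnTree.kernel t).costAt = t.costAt := by
      funext p; simp [costAt, step?]
    have e2 : (SpawnTree.kernel t).Edge R = t.Edge R := by
      funext p q; simp [Edge]
    rw [e2] at h
    rw [e1]
    exact ih path h
  | node k l r ihl ihr =>
    intro path h
    have cl : ∀ p : List (List Bool),
        ((p.map (false :: ·)).map (node k l r).costAt) = p.map l.costAt := by
      intro p; rw [List.map_map]; congr 1
    have cr : ∀ p : List (List Bool),
        ((p.map (true :: ·)).map (node k l r).costAt) = p.map r.costAt := by
      intro p; rw [List.map_map]; congr 1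
    have hmax : max l.span r.span ≤ (node k l r).span := by
      cases k <;> simp [span]
    rcases path with _ | ⟨p, rest⟩
    · simp
    · rcases p with _ | ⟨_ | _, q⟩
      · rcases rest with _ | ⟨x, rest⟩
        · simp [costAt, step?]
        · rw [List.isChain_cons_cons] at h
          exact absurd h.1 (by simp [Edge])
      · obtain ⟨p₁, p₂, rfl, h1, h2, h3⟩ := chain_node_false rest q h
        have e : (false :: q) :: (p₁.map (false :: ·) ++ p₂.map (true :: ·)) =
            (q :: p₁).map (false :: ·) ++ p₂.map (true :: ·) := rfl
        rw [e, List.map_append, cl, cr, List.sum_append]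
        have := ihl _ h1
        have := ihr _ h2
        by_cases hk : k = Comp.par
        · rw [h3 hk, List.map_nil, List.sum_nil]
          omega
        · have : (node k l r).span = l.span + r.span := by
            cases k <;> simp_all [span]
          omega
      · obtain ⟨p₂, rfl, h2⟩ := chain_node_true rest q h
        have e : (true :: q) :: (p₂.map (true :: ·)) = (q :: p₂).map (true :: ·) := rfl
        rw [e, cr]
        have := ihr _ h2
        omega

/-! ### Races -/

/-- The cells written, in serial order. -/
def SpawnTree.writes : SpawnTree → List ℕ
  | leaf s => s.writes
  | node _ l r => l.writes ++ r.writes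
  | kernel t => t.writes

/-- Parallel tasks do not interfere, and there are no partial dependencies. -/
def SpawnTree.Safe : SpawnTree → Prop
  | leaf _ => True
  | node Comp.seq l r => l.Safe ∧ r.Safe
  | node Comp.par l r => l.Safe ∧ r.Safe ∧ (∀ x ∈ l.writes, x ∉ r.trace) ∧
      (∀ x ∈ r.writes, x ∉ l.trace)
  | node (Comp.fire _) _ _ => False
  | kernel t => t.Safe

theorem SpawnTree.mem_of_step? (t : SpawnTree) : ∀ (p : List Bool) (s : Step), t.step? p = some s →
    (∀ x ∈ s.writes, x ∈ t.writes) ∧ ∀ x ∈ s.reads ++ s.writes, x ∈ t.trace := by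
  induction t with
  | leaf s' =>
    intro p s h
    rcases p with _ | ⟨b, p⟩
    · simp only [step?, Option.some.injEq] at h
      subst h
      exact ⟨fun x hx => hx, fun x hx => hx⟩
    · simp [step?] at h
  | kernel t ih => exact fun p s h => ih p s (by simpa [step?] using h)
  | node k l r ihl ihr =>
    intro p s h
    rcases p with _ | ⟨_ | _, p⟩
    · simp [step?] at h
    · obtain ⟨h1, h2⟩ := ihl p s (by simpa [step?] using h)
      exact ⟨fun x hx => List.mem_append_left _ (h1 x hx),
        fun x hx => List.mem_append_left _ (h2 x hx)⟩
    · obtain ⟨h1, h2⟩ := ihr p s (by simpa [step?] using h)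
      exact ⟨fun x hx => List.mem_append_right _ (h1 x hx),
        fun x hx => List.mem_append_right _ (h2 x hx)⟩

/-- Two distinct leaves separate at a unique node. If it is serial, there is a direct edge between
them; if it is parallel, a cell written by one is not accessed by the other. -/
theorem SpawnTree.Safe.raceFree (R : List (List FireRule)) {t : SpawnTree} (ht : t.Safe) :
    t.RaceFree R := by
  induction t with
  | leaf s' =>
    intro p q s s' hpq hp hq
    rcases p with _ | ⟨b, p⟩ <;> rcases q with _ | ⟨b', q⟩ <;> simp [step?] at hp hq hpq
  | kernel t ih =>
    have e2 : (SpawnTree.kernel t).Edge R = t.Edge R := by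
      funext p q; simp [Edge]
    intro p q s s' hpq hp hq
    rw [e2]
    exact ih ht p q s s' hpq (by simpa [step?] using hp) (by simpa [step?] using hq)
  | node k l r ihl ihr =>
    have hl : l.Safe := by cases k <;> simp_all [Safe]
    have hr : r.Safe := by cases k <;> simp_all [Safe]
    intro p q s s' hpq hp hq x hx hx'
    rcases p with _ | ⟨_ | _, p⟩
    · simp [step?] at hp
    all_goals rcases q with _ | ⟨_ | _, q⟩
    · simp [step?] at hq
    · refine (ihl hl p q s s' (by simpa using hpq) (by simpa [step?] using hp)
        (by simpa [step?] using hq) x hx hx').imp ?_ ?_ <;>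
      exact fun h => h.lift (false :: ·) fun a b hab => by simpa [Edge] using hab
    · simp only [step?] at hp hq
      cases k with
      | seq =>
        refine .inl (.single ?_)
        simp only [Edge]
        exact .seq (by simp [hp]) (by simp [hq])
      | par =>
        exact absurd ((r.mem_of_step? _ _ hq).2 x hx') (ht.2.2.1 x ((l.mem_of_step? _ _ hp).1 x hx))
      | fire => exact ht.elim
    · simp [step?] at hq
    · simp only [step?] at hp hq
      cases k with
      | seq =>
        refine .inr (.single ?_)
        simp only [Edge]
        exact .seq (by simp [hq]) (by simp [hp])
      | par =>
        exact absurd ((l.mem_of_step? _ _ hq).2 x hx') (ht.2.2.2 x ((r.mem_of_step? _ _ hp).1 x hx))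
      | fire => exact ht.elim
    · refine (ihr hr p q s s' (by simpa using hpq) (by simpa [step?] using hp)
        (by simpa [step?] using hq) x hx hx').imp ?_ ?_ <;>
      exact fun h => h.lift (true :: ·) fun a b hab => by simpa [Edge] using hab

/-! ### Determinism and lower bound on the work -/

/-- Lets bounds shown for one constructed execution apply to every execution. -/
theorem Exec.deterministic {P : Program} {w : ℕ → ℕ → ℝ} {s : Stmt} {env : List ℕ} {m m₁ m₂ : ℕ → ℝ}
    {t₁ t₂ : SpawnTree} (h₁ : Exec P w s env m t₁ m₁) (h₂ : Exec P w s env m t₂ m₂) :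
    t₁ = t₂ ∧ m₁ = m₂ := by
  induction h₁ generalizing t₂ m₂ with
  | skip => cases h₂; exact ⟨rfl, rfl⟩
  | store => cases h₂; exact ⟨rfl, rfl⟩
  | comp k _ _ ih ih' =>
    cases h₂ with
    | comp _ a b =>
      obtain ⟨rfl, rfl⟩ := ih a
      obtain ⟨rfl, rfl⟩ := ih' b
      exact ⟨rfl, rfl⟩
  | iteTrue _ hc _ ih =>
    cases h₂ with
    | iteTrue _ _ a => obtain ⟨rfl, rfl⟩ := ih a; exact ⟨rfl, rfl⟩
    | iteFalse _ hc' a => exact absurd hc hc'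
  | iteFalse _ hc _ ih =>
    cases h₂ with
    | iteTrue _ hc' a => exact absurd hc' hc
    | iteFalse _ _ a => obtain ⟨rfl, rfl⟩ := ih a; exact ⟨rfl, rfl⟩
  | call hf _ ih =>
    cases h₂ with
    | call hf' a =>
      obtain rfl := Option.some.inj (hf.symm.trans hf')
      obtain ⟨rfl, rfl⟩ := ih a
      exact ⟨rfl, rfl⟩
  | kernel _ ih =>
    cases h₂ with
    | kernel a => obtain ⟨rfl, rfl⟩ := ih a; exact ⟨rfl, rfl⟩

/-- The pairs at which an expression evaluates the weight function. -/
def RExp.queries (env : List ℕ) : RExp → List (ℕ × ℕ)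
  | lit _ => []
  | mem _ => []
  | weight i j => [(i.eval env, j.eval env)]
  | add x y => x.queries env ++ y.queries env
  | sub x y => x.queries env ++ y.queries env
  | mul x y => x.queries env ++ y.queries env
  | min x y => x.queries env ++ y.queries env
  | max x y => x.queries env ++ y.queries env

theorem RExp.length_queries_le (env : List ℕ) (x : RExp) : (x.queries env).length ≤ x.cost := by
  induction x <;> simp only [queries, cost, List.length_append, List.length_nil,
    List.length_singleton] <;> omega

theorem RExp.length_reads_le (env : List ℕ) (x : RExp) : (x.reads env).length ≤ x.cost := by
  induction x <;> simp only [reads, cost, List.length_append, List.length_nil,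
    List.length_singleton] <;> omega

theorem RExp.eval_congr_queries {w w' : ℕ → ℕ → ℝ} (env : List ℕ) (m : ℕ → ℝ) (x : RExp)
    (h : ∀ p ∈ x.queries env, w' p.1 p.2 = w p.1 p.2) : x.eval w' env m = x.eval w env m := by
  induction x with
  | lit | mem => rfl
  | weight i j => exact h (i.eval env, j.eval env) (by simp [queries])
  | _ x y ihx ihy =>
    simp only [queries, List.mem_append] at h
    simp only [eval, ihx fun p hp => h p (.inl hp), ihy fun p hp => h p (.inr hp)]

/-- The pairs at which a test evaluates the weight function. -/
def Test.queries (env : List ℕ) : Test → List (ℕ × ℕ)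
  | ile _ _ => []
  | rle x y => x.queries env ++ y.queries env

theorem Test.length_queries_le (env : List ℕ) (c : Test) : (c.queries env).length ≤ c.cost := by
  cases c with
  | ile => simp [queries]
  | rle x y =>
    have := x.length_queries_le env
    have := y.length_queries_le env
    simp only [queries, cost, List.length_append]
    omega

theorem Test.length_reads_le (env : List ℕ) (c : Test) : (c.reads env).length ≤ c.cost := by
  cases c with
  | ile => simp [reads]
  | rle x y =>
    have := x.length_reads_le env
    have := y.length_reads_le env
    simp only [reads, cost, List.length_append]
    omega

theorem Test.holds_congr_queries {w w' : ℕ → ℕ → ℝ} (env : List ℕ) (m : ℕ → ℝ) (c : Test)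
    (h : ∀ p ∈ c.queries env, w' p.1 p.2 = w p.1 p.2) : c.Holds w' env m ↔ c.Holds w env m := by
  cases c with
  | ile => exact Iff.rfl
  | rle x y =>
    simp only [queries, List.mem_append] at h
    simp only [Holds, x.eval_congr_queries env m fun p hp => h p (.inl hp),
      y.eval_congr_queries env m fun p hp => h p (.inr hp)]

theorem Exec.length_trace_le {P : Program} {w : ℕ → ℕ → ℝ} {s : Stmt} {env : List ℕ}
    {m m' : ℕ → ℝ} {t : SpawnTree} (h : Exec P w s env m t m') : t.trace.length ≤ t.work := by
  induction h with
  | skip => simp [SpawnTree.trace]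
  | store a x env m =>
    have := x.length_reads_le env
    simp only [SpawnTree.trace, SpawnTree.work, List.length_append, List.length_singleton]
    omega
  | comp => simp only [SpawnTree.trace, SpawnTree.work, List.length_append]; omega
  | @iteTrue c _ _ env _ _ _ _ _ _ | @iteFalse c _ _ env _ _ _ _ _ _ =>
    have := c.length_reads_le env
    simp only [SpawnTree.trace, SpawnTree.work, List.length_append, List.length_nil]
    omega
  | call => simp only [SpawnTree.trace, SpawnTree.work, List.length_append, List.length_nil]; omega
  | kernel => simpa only [SpawnTree.trace, SpawnTree.work]

/-- An execution depends on the weight function at a number of pairs that the work bounds. -/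
theorem Exec.exists_queries {P : Program} {w : ℕ → ℕ → ℝ} {s : Stmt} {env : List ℕ}
    {m m' : ℕ → ℝ} {t : SpawnTree} (h : Exec P w s env m t m') :
    ∃ L : List (ℕ × ℕ), L.length ≤ t.work ∧
      ∀ w' : ℕ → ℕ → ℝ, (∀ p ∈ L, w' p.1 p.2 = w p.1 p.2) → Exec P w' s env m t m' := by
  induction h with
  | skip env m => exact ⟨[], by simp, fun w' _ => .skip env m⟩
  | store a x env m =>
    refine ⟨x.queries env, ?_, fun w' hw => ?_⟩
    · have := x.length_queries_le env
      simp only [SpawnTree.work]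
      omega
    · rw [← x.eval_congr_queries env m hw]
      exact .store a x env m
  | comp k _ _ ih ih' =>
    obtain ⟨L, h1, h2⟩ := ih
    obtain ⟨L', h1', h2'⟩ := ih'
    refine ⟨L ++ L', by simp only [SpawnTree.work, List.length_append]; omega, fun w' hw => ?_⟩
    exact .comp k (h2 w' fun p hp => hw p (List.mem_append_left _ hp))
      (h2' w' fun p hp => hw p (List.mem_append_right _ hp))
  | @iteTrue c _ s₂ env m _ _ hc _ ih =>
    obtain ⟨L, h1, h2⟩ := ih
    have := c.length_queries_le env
    refine ⟨c.queries env ++ L, by simp only [SpawnTree.work, List.length_append]; omega,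
      fun w' hw => ?_⟩
    exact .iteTrue s₂ ((c.holds_congr_queries env m fun p hp =>
      hw p (List.mem_append_left _ hp)).2 hc) (h2 w' fun p hp => hw p (List.mem_append_right _ hp))
  | @iteFalse c s₁ _ env m _ _ hc _ ih =>
    obtain ⟨L, h1, h2⟩ := ih
    have := c.length_queries_le env
    refine ⟨c.queries env ++ L, by simp only [SpawnTree.work, List.length_append]; omega,
      fun w' hw => ?_⟩
    exact .iteFalse s₁ (mt (c.holds_congr_queries env m fun p hp =>
      hw p (List.mem_append_left _ hp)).1 hc) (h2 w' fun p hp => hw p (List.mem_append_right _ hp))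
  | call hf _ ih =>
    obtain ⟨L, h1, h2⟩ := ih
    exact ⟨L, by simp only [SpawnTree.work]; omega, fun w' hw => .call hf (h2 w' hw)⟩
  | kernel _ ih =>
    obtain ⟨L, h1, h2⟩ := ih
    exact ⟨L, by simpa only [SpawnTree.work], fun w' hw => .kernel (h2 w' hw)⟩

/-- Adversary argument: each of the n(n+1)/2 relevant weights must be evaluated, at unit cost at
least. -/
theorem Program.Computes1D.work_ge {P : Program} {n : ℕ} (hP : P.Computes1D n)
    {w : ℕ → ℕ → ℝ} {m : ℕ → ℝ} {t : SpawnTree} {m' : ℕ → ℝ} (h : P.Run w n m t m') :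
    n ^ 2 ≤ 2 * t.work := by
  obtain ⟨L, hL, hw⟩ := Exec.exists_queries h
  have key : ∀ i j, i < j → j ≤ n → (i, j) ∈ L := by
    intro i j hij hj
    by_contra hmem
    -- The run is the same for `w'`, yet the candidate through `i` is now `m' j - 1`, smaller than
    -- the claimed minimum `m' j`.
    let w' : ℕ → ℕ → ℝ := fun a b => if (a, b) = (i, j) then m' j - m' i - 1 else w a b
    have hrun : P.Run w' n m t m' := hw w' fun p hp => by
      have : (p.1, p.2) ≠ (i, j) := fun h => hmem (h ▸ hp)
      simp only [w', if_neg this]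
    obtain ⟨t₂, m₂, h₂, hsol⟩ := hP w' m
    obtain ⟨-, rfl⟩ := Exec.deterministic hrun h₂
    have := (hsol.2 j (by omega) hj).2 ⟨i, hij, rfl⟩
    simp only [w', if_true] at this
    linarith
  have hsub : (Finset.range (n + 1)).sigma (fun j => Finset.range j) ⊆
      L.toFinset.image fun p => ⟨p.2, p.1⟩ := by
    rintro ⟨j, i⟩ hji
    simp only [Finset.mem_sigma, Finset.mem_range] at hji
    simp only [Finset.mem_image, List.mem_toFinset]
    exact ⟨(i, j), key i j hji.2 (by omega), rfl⟩
  have h1 := (Finset.card_le_card hsub).trans (Finset.card_image_le.trans L.toFinset_card_le)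
  rw [Finset.card_sigma] at h1
  simp only [Finset.card_range] at h1
  have h2 := Finset.sum_range_id_mul_two (n + 1)
  simp only [Nat.add_sub_cancel] at h2
  nlinarith

/-! ### Cache misses of a segment of the execution -/

/-- Serving the segment `ls` costs at most `q` misses, whatever the cache holds before and whatever
is requested after it. -/
def SegmentMissesLE (k : ℕ) (ls : List ℕ) (q : ℕ) : Prop :=
  ∀ (C : Finset ℕ) (ls' : List ℕ) (q' : ℕ), (∀ C', ∃ q'' ≤ q', Serves k C' ls' q'') →
    ∃ q'' ≤ q + q', Serves k C (ls ++ ls') q''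

theorem SegmentMissesLE.nil (k : ℕ) : SegmentMissesLE k [] 0 := fun C ls' q' h => by
  simpa using h C

/-- Quantifying over the initial cache and over the continuation is what makes miss bounds additive.
-/
theorem SegmentMissesLE.append {k : ℕ} {l₁ l₂ : List ℕ} {q₁ q₂ : ℕ} (h₁ : SegmentMissesLE k l₁ q₁)
    (h₂ : SegmentMissesLE k l₂ q₂) : SegmentMissesLE k (l₁ ++ l₂) (q₁ + q₂) := fun C ls' q' h => by
  rw [List.append_assoc, add_assoc]
  exact h₁ C _ _ fun C' => h₂ C' _ _ h

/-- A segment whose lines fit into the cache loads each of them at most once. -/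
theorem SegmentMissesLE.of_subset {k : ℕ} {ls : List ℕ} {F : Finset ℕ} (hF : F.card ≤ k)
    (h : ∀ x ∈ ls, x ∈ F) : SegmentMissesLE k ls F.card := by
  -- The potential is the number of lines of `F` not yet in the cache; each miss lowers it, because
  -- only lines outside `F` are evicted.
  have key : ∀ (ls : List ℕ), (∀ x ∈ ls, x ∈ F) → ∀ (C : Finset ℕ) (ls' : List ℕ) (q' : ℕ),
      (∀ C', ∃ q'' ≤ q', Serves k C' ls' q'') →
      ∃ q'' ≤ (F \ C).card + q', Serves k C (ls ++ ls') q'' := by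
    intro ls
    induction ls with
    | nil =>
      intro _ C ls' q' h
      obtain ⟨q'', h1, h2⟩ := h C
      exact ⟨q'', by omega, h2⟩
    | cons x ls ih =>
      intro hls C ls' q' h
      have hxF := hls x List.mem_cons_self
      have ih' := ih fun y hy => hls y (List.mem_cons_of_mem _ hy)
      by_cases hx : x ∈ C
      · obtain ⟨q'', h1, h2⟩ := ih' C ls' q' h
        exact ⟨q'', h1, .hit hx h2⟩
      · have hx' : x ∉ C ∩ F := fun hh => hx (Finset.mem_inter.1 hh).1
        obtain ⟨q'', h1, h2⟩ := ih' (insert x (C ∩ F)) ls' q' h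
        have hc : (C ∩ F).card + 1 ≤ k := by
          rw [← Finset.card_insert_of_notMem hx']
          refine (Finset.card_le_card ?_).trans hF
          exact Finset.insert_subset hxF Finset.inter_subset_right
        refine ⟨q'' + 1, ?_, .miss hx Finset.inter_subset_left hc h2⟩
        have : (F \ insert x (C ∩ F)).card + 1 ≤ (F \ C).card := by
          have hx2 : x ∉ F \ insert x (C ∩ F) := by simp
          rw [← Finset.card_insert_of_notMem hx2]
          refine Finset.card_le_card fun y hy => ?_
          simp only [Finset.mem_insert, Finset.mem_sdiff, Finset.mem_inter] at hy ⊢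
          rcases hy with rfl | hy
          · exact ⟨hxF, hx⟩
          · exact ⟨hy.1, fun hC => hy.2 (.inr ⟨hC, hy.1⟩)⟩
        omega
  intro C ls' q' h'
  obtain ⟨q'', h1, h2⟩ := key ls h C ls' q' h'
  have := Finset.card_le_card (Finset.sdiff_subset (s := F) (t := C))
  exact ⟨q'', by omega, h2⟩

theorem SegmentMissesLE.of_length {k : ℕ} (hk : 1 ≤ k) (ls : List ℕ) :
    SegmentMissesLE k ls ls.length := by
  induction ls with
  | nil => exact .nil k
  | cons x ls ih =>
    rw [List.length_cons, add_comm]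
    exact SegmentMissesLE.append (l₁ := [x]) (q₁ := 1)
      (.of_subset (F := {x}) (by simpa using hk) (by simp)) ih

theorem SegmentMissesLE.exists_serves {k : ℕ} {ls : List ℕ} {q : ℕ} (h : SegmentMissesLE k ls q) :
    ∃ q' ≤ q, Serves k ∅ ls q' := by
  simpa using h ∅ [] 0 fun C' => ⟨0, le_rfl, .nil C'⟩

/-- The lines that meet an interval of cells. -/
theorem card_lines_le {B : ℕ} (hB : 1 ≤ B) (a b : ℕ) :
    (Finset.Icc (a / B) (b / B)).card ≤ (b - a) / B + 2 := by
  rw [Nat.card_Icc]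
  have h1 : b / B ≤ a / B + (b - a) / B + 1 := by
    calc b / B ≤ (a + (b - a)) / B := Nat.div_le_div_right (by omega)
      _ ≤ _ := by
        rw [Nat.add_div hB]
        split
        · exact le_rfl
        · exact Nat.le_succ _
  generalize b / B = p at *
  generalize a / B = q at *
  generalize (b - a) / B = r at *
  omega

/-! ### Executions with resource bounds -/

/-- `s` executes from `m` to `m'` without races, accesses only cells of `A`, writes only cells of
`W`, and consists of at most `c` steps, at most `d` of them on a path, each of cost at most `100`;
its cache misses move at most `x` cells. -/
def Runs (k B : ℕ) (P : Program) (w : ℕ → ℕ → ℝ) (s : Stmt) (env : List ℕ) (m m' : ℕ → ℝ)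
    (A W : Set ℕ) (c d x : ℕ) : Prop :=
  ∃ t : SpawnTree, Exec P w s env m t m' ∧ t.Safe ∧ (∀ y ∈ t.trace, y ∈ A) ∧
    (∀ y ∈ t.writes, y ∈ W) ∧ t.work ≤ 100 * c ∧ t.span ≤ 100 * d ∧
    ∃ q, B * q ≤ x ∧ SegmentMissesLE k (t.trace.map (· / B)) q

theorem Exec.eq_of_notMem_writes {P : Program} {w : ℕ → ℕ → ℝ} {s : Stmt} {env : List ℕ}
    {m m' : ℕ → ℝ} {t : SpawnTree} (h : Exec P w s env m t m') :
    ∀ y, y ∉ t.writes → m' y = m y := by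
  induction h with
  | skip => exact fun _ _ => rfl
  | store a x env m =>
    intro y hy
    exact Function.update_of_ne (by simpa [SpawnTree.writes] using hy) _ _
  | comp _ _ _ ih ih' =>
    intro y hy
    simp only [SpawnTree.writes, List.mem_append, not_or] at hy
    rw [ih' y hy.2, ih y hy.1]
  | iteTrue _ _ _ ih | iteFalse _ _ _ ih | call _ _ ih =>
    exact fun y hy => ih y (by simpa [SpawnTree.writes] using hy)
  | kernel _ ih => exact fun y hy => ih y (by simpa [SpawnTree.writes] using hy)

namespace Runs

variable {k B : ℕ} {P : Program} {w : ℕ → ℕ → ℝ} {s s₁ s₂ : Stmt} {env : List ℕ}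
  {m m' m₁ m₂ : ℕ → ℝ} {A W A₁ W₁ A₂ W₂ : Set ℕ} {c d x c₁ d₁ x₁ c₂ d₂ x₂ : ℕ}

theorem frame (h : Runs k B P w s env m m' A W c d x) : ∀ y, y ∉ W → m' y = m y := by
  obtain ⟨t, h, -, -, hW, -⟩ := h
  exact fun y hy => h.eq_of_notMem_writes y fun hy' => hy (hW y hy')

theorem mono (h : Runs k B P w s env m m' A W c d x) (hA : ∀ y ∈ A, y ∈ A₁) (hW : ∀ y ∈ W, y ∈ W₁)
    (hc : c ≤ c₁) (hd : d ≤ d₁) (hx : x ≤ x₁) : Runs k B P w s env m m' A₁ W₁ c₁ d₁ x₁ := by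
  obtain ⟨t, h, hs, hA', hW', hc', hd', q, hq, hq'⟩ := h
  exact ⟨t, h, hs, fun y hy => hA y (hA' y hy), fun y hy => hW y (hW' y hy), by omega, by omega,
    q, by omega, hq'⟩

/-- Discards the accumulated miss bound in favour of loading each line once, for a task whose
footprint fits into the cache. -/
theorem of_lines (h : Runs k B P w s env m m' A W c d x) (F : Finset ℕ) (hF : F.card ≤ k)
    (hA : ∀ y ∈ A, y / B ∈ F) : Runs k B P w s env m m' A W c d (B * F.card) := by
  obtain ⟨t, h, hs, hA', hW', hc', hd', -⟩ := h
  refine ⟨t, h, hs, hA', hW', hc', hd', F.card, le_rfl, .of_subset hF fun y hy => ?_⟩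
  obtain ⟨z, hz, rfl⟩ := List.mem_map.1 hy
  exact hA z (hA' z hz)

theorem skip : Runs k B P w .skip env m m ∅ ∅ 1 1 0 :=
  ⟨_, .skip env m, trivial, by simp [SpawnTree.trace], by simp [SpawnTree.writes],
    by simp [SpawnTree.work], by simp [SpawnTree.span], 0, by simp, .nil k⟩

theorem store {a : IExp} {x : RExp} (hk : 1 ≤ k) (hcost : a.cost + x.cost + 1 ≤ 100) :
    Runs k B P w (.store a x) env m (Function.update m (a.eval env) (x.eval w env m))
      {y | y ∈ x.reads env ∨ y = a.eval env} {a.eval env} 1 1 (B * ((x.reads env).length + 1)) := by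
  refine ⟨_, .store a x env m, trivial, ?_, by simp [SpawnTree.writes], hcost, hcost, _, le_rfl, ?_⟩
  · simp [SpawnTree.trace]
  · simpa [SpawnTree.trace] using SegmentMissesLE.of_length hk
      ((x.reads env ++ [a.eval env]).map (· / B))

theorem seq (h₁ : Runs k B P w s₁ env m m₁ A₁ W₁ c₁ d₁ x₁)
    (h₂ : Runs k B P w s₂ env m₁ m₂ A₂ W₂ c₂ d₂ x₂) :
    Runs k B P w (.comp .seq s₁ s₂) env m m₂ (A₁ ∪ A₂) (W₁ ∪ W₂) (c₁ + c₂) (d₁ + d₂) (x₁ + x₂) := by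
  obtain ⟨t, h, hs, hA, hW, hc, hd, q, hq, hq'⟩ := h₁
  obtain ⟨t', h', hs', hA', hW', hc', hd', r, hr, hr'⟩ := h₂
  refine ⟨_, .comp .seq h h', ⟨hs, hs'⟩, ?_, ?_, ?_, ?_, q + r, by rw [mul_add]; omega, ?_⟩
  · intro y hy
    exact (List.mem_append.1 hy).imp (hA y) (hA' y)
  · intro y hy
    exact (List.mem_append.1 hy).imp (hW y) (hW' y)
  · simp only [SpawnTree.work]; omega
  · simp only [SpawnTree.span]; omega
  · simpa [SpawnTree.trace] using hq'.append hr'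

theorem par (h₁ : Runs k B P w s₁ env m m₁ A₁ W₁ c₁ d₁ x₁)
    (h₂ : Runs k B P w s₂ env m₁ m₂ A₂ W₂ c₂ d₂ x₂)
    (h₁₂ : ∀ y ∈ W₁, y ∉ A₂) (h₂₁ : ∀ y ∈ W₂, y ∉ A₁) :
    Runs k B P w (.comp .par s₁ s₂) env m m₂ (A₁ ∪ A₂) (W₁ ∪ W₂) (c₁ + c₂) (max d₁ d₂)
      (x₁ + x₂) := by
  obtain ⟨t, h, hs, hA, hW, hc, hd, q, hq, hq'⟩ := h₁
  obtain ⟨t', h', hs', hA', hW', hc', hd', r, hr, hr'⟩ := h₂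
  refine ⟨_, .comp .par h h', ⟨hs, hs', ?_, ?_⟩, ?_, ?_, ?_, ?_, q + r, by rw [mul_add]; omega, ?_⟩
  · exact fun y hy hy' => h₁₂ y (hW y hy) (hA' y hy')
  · exact fun y hy hy' => h₂₁ y (hW' y hy) (hA y hy')
  · intro y hy
    exact (List.mem_append.1 hy).imp (hA y) (hA' y)
  · intro y hy
    exact (List.mem_append.1 hy).imp (hW y) (hW' y)
  · simp only [SpawnTree.work]; omega
  · simp only [SpawnTree.span]; omega
  · simpa [SpawnTree.trace] using hq'.append hr'

theorem iteTrue {a b : IExp} (hc : a.eval env ≤ b.eval env) (hcost : a.cost + b.cost + 2 ≤ 100)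
    (h : Runs k B P w s₁ env m m' A W c d x) :
    Runs k B P w (.ite (.ile a b) s₁ s₂) env m m' A W (1 + c) (1 + d) x := by
  obtain ⟨t, h, hs, hA, hW, hc', hd, q, hq, hq'⟩ := h
  refine ⟨_, .iteTrue s₂ hc h, ⟨trivial, hs⟩, hA, hW, ?_, ?_, q, hq, hq'⟩
  · simp only [SpawnTree.work, Test.cost]; omega
  · simp only [SpawnTree.span, Test.cost]; omega

theorem iteFalse {a b : IExp} (hc : b.eval env < a.eval env) (hcost : a.cost + b.cost + 2 ≤ 100)
    (h : Runs k B P w s₂ env m m' A W c d x) :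
    Runs k B P w (.ite (.ile a b) s₁ s₂) env m m' A W (1 + c) (1 + d) x := by
  obtain ⟨t, h, hs, hA, hW, hc', hd, q, hq, hq'⟩ := h
  refine ⟨_, .iteFalse s₁ (fun h : a.eval env ≤ b.eval env => by omega) h, ⟨trivial, hs⟩,
    hA, hW, ?_, ?_, q, hq, hq'⟩
  · simp only [SpawnTree.work, Test.cost]; omega
  · simp only [SpawnTree.span, Test.cost]; omega

theorem call {f : ℕ} {args : List IExp} {body : Stmt} {env' : List ℕ} (hf : P.procs[f]? = some body)
    (henv : args.map (IExp.eval env) = env') (hcost : (args.map IExp.cost).sum + 1 ≤ 100)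
    (h : Runs k B P w body env' m m' A W c d x) :
    Runs k B P w (.call f args) env m m' A W (1 + c) (1 + d) x := by
  obtain ⟨t, h, hs, hA, hW, hc', hd, q, hq, hq'⟩ := h
  subst henv
  refine ⟨_, .call hf h, ⟨trivial, hs⟩, hA, hW, ?_, ?_, q, hq, hq'⟩
  · simp only [SpawnTree.work]; omega
  · simp only [SpawnTree.span]; omega

end Runs

/-! ### Divide and conquer over an interval of indices -/

/-- Body of a procedure `f` with parameters `lo`, `hi` and three further ones: run `leaf` on single
indices, the two halves of longer intervals in parallel, and then `comb`. -/
def dncBody (f : ℕ) (leaf comb : Stmt) : Stmt :=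
  .ite (.ile (.var 1) (.add (.var 0) (.lit 1))) leaf
    (.comp .seq
      (.comp .par
        (.call f [.var 0, .div (.add (.var 0) (.var 1)) (.lit 2), .var 2, .var 3, .var 4])
        (.call f [.div (.add (.var 0) (.var 1)) (.lit 2), .var 1, .var 2, .var 3, .var 4]))
      comb)

/-- The union of `S i` for `lo ≤ i < hi`. -/
def unionIco (S : ℕ → Set ℕ) (lo hi : ℕ) : Set ℕ := {y | ∃ i, lo ≤ i ∧ i < hi ∧ y ∈ S i}

theorem unionIco_mono {S : ℕ → Set ℕ} {lo hi lo' hi' : ℕ} (h : lo' ≤ lo) (h' : hi ≤ hi') :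
    ∀ y ∈ unionIco S lo hi, y ∈ unionIco S lo' hi' := by
  rintro y ⟨i, h1, h2, h3⟩
  exact ⟨i, by omega, by omega, h3⟩

/-- Induction on the depth `L`. By `hdisj` the halves do not interfere, and by `hstab` the result of
the first half survives the second. Leaves see the original memory `m₀` outside the written cells.
The miss bound `X` may be justified at each length either by a footprint that fits into the cache or
by the recurrence over the two halves. -/
theorem Runs.dnc {k B : ℕ} {P : Program} {w : ℕ → ℕ → ℝ} {f : ℕ} {leaf comb : Stmt}
    (hP : P.procs[f]? = some (dncBody f leaf comb)) {e₁ e₂ e₃ Lo Hi : ℕ} (m₀ : ℕ → ℝ)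
    (A W : ℕ → Set ℕ) (Post : ℕ → ℕ → (ℕ → ℝ) → Prop) (cl dl xc : ℕ) (X : ℕ → ℕ)
    (hWA : ∀ i, Lo ≤ i → i < Hi → ∀ y ∈ W i, y ∈ A i)
    (hdisj : ∀ i j, Lo ≤ i → i < Hi → Lo ≤ j → j < Hi → i ≠ j → ∀ y ∈ W i, y ∉ A j)
    (hstab : ∀ lo hi m m', lo < hi → hi ≤ Hi → Post lo hi m →
      (∀ y ∈ unionIco W lo hi, m' y = m y) → Post lo hi m')
    (hleaf : ∀ i m, Lo ≤ i → i < Hi → (∀ y, y ∉ unionIco W Lo Hi → m y = m₀ y) →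
      ∃ m', Runs k B P w leaf [i, i + 1, e₁, e₂, e₃] m m' (A i) (W i) cl dl (X 1) ∧
        Post i (i + 1) m')
    (hcomb : ∀ lo mid hi m, Lo ≤ lo → lo < mid → mid < hi → hi ≤ Hi → mid = (lo + hi) / 2 →
      Post lo mid m → Post mid hi m →
      ∃ m', Runs k B P w comb [lo, hi, e₁, e₂, e₃] m m' (unionIco A lo hi) (unionIco W lo hi) 1 1 xc ∧
        Post lo hi m')
    (hX : ∀ lo hi, Lo ≤ lo → lo + 1 < hi → hi ≤ Hi →
      (∃ F : Finset ℕ, F.card ≤ k ∧ (∀ y ∈ unionIco A lo hi, y / B ∈ F) ∧ B * F.card ≤ X (hi - lo)) ∨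
      X ((hi - lo) / 2) + X ((hi - lo) - (hi - lo) / 2) + xc ≤ X (hi - lo)) (L : ℕ) :
    ∀ lo hi m, Lo ≤ lo → lo < hi → hi ≤ Hi → hi - lo ≤ 2 ^ L →
      (∀ y, y ∉ unionIco W Lo Hi → m y = m₀ y) →
      ∃ m', Runs k B P w (dncBody f leaf comb) [lo, hi, e₁, e₂, e₃] m m' (unionIco A lo hi)
        (unionIco W lo hi) ((hi - lo) * (cl + 5) - 4) (dl + 1 + 3 * L) (X (hi - lo)) ∧
        Post lo hi m' := by
  have base : ∀ L lo m, Lo ≤ lo → lo + 1 ≤ Hi → (∀ y, y ∉ unionIco W Lo Hi → m y = m₀ y) →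
      ∃ m', Runs k B P w (dncBody f leaf comb) [lo, lo + 1, e₁, e₂, e₃] m m' (unionIco A lo (lo + 1))
        (unionIco W lo (lo + 1)) ((lo + 1 - lo) * (cl + 5) - 4) (dl + 1 + 3 * L) (X (lo + 1 - lo)) ∧
        Post lo (lo + 1) m' := by
    intro L lo m hlo hhi hm
    obtain ⟨m', h, hp⟩ := hleaf lo m hlo hhi hm
    refine ⟨m', ?_, hp⟩
    have e : lo + 1 - lo = 1 := by omega
    rw [e]
    refine (Runs.iteTrue (by simp [IExp.eval]) (by simp [IExp.cost]) h).mono ?_ ?_ ?_ ?_ le_rfl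
    · exact fun y hy => ⟨lo, le_rfl, by omega, hy⟩
    · exact fun y hy => ⟨lo, le_rfl, by omega, hy⟩
    · omega
    · omega
  induction L with
  | zero =>
    intro lo hi m hlo hlt hhi hL hm
    obtain rfl : hi = lo + 1 := by simp at hL; omega
    exact base 0 lo m hlo hhi hm
  | succ L ih =>
    intro lo hi m hlo hlt hhi hL hm
    rcases Nat.lt_or_ge (lo + 1) hi with hlen | hlen
    swap
    · obtain rfl : hi = lo + 1 := by omega
      exact base (L + 1) lo m hlo hhi hm
    obtain ⟨mid, hmid⟩ : ∃ mid, mid = (lo + hi) / 2 := ⟨_, rfl⟩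
    have h1 : lo < mid := by omega
    have h2 : mid < hi := by omega
    have hpow : 2 ^ (L + 1) = 2 * 2 ^ L := by rw [pow_succ, mul_comm]
    obtain ⟨m₁, hr₁, hp₁⟩ := ih lo mid m hlo h1 (by omega) (by omega) hm
    have hm₁ : ∀ y, y ∉ unionIco W Lo Hi → m₁ y = m₀ y := fun y hy => by
      rw [hr₁.frame y (fun h => hy (unionIco_mono hlo (by omega) y h)), hm y hy]
    obtain ⟨m₂, hr₂, hp₂⟩ := ih mid hi m₁ (by omega) h2 hhi (by omega) hm₁
    have hWA' : ∀ y ∈ unionIco W mid hi, y ∈ unionIco A mid hi := by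
      rintro y ⟨i, hi1, hi2, hi3⟩
      exact ⟨i, hi1, hi2, hWA i (by omega) (by omega) y hi3⟩
    have hd₁ : ∀ y ∈ unionIco W lo mid, y ∉ unionIco A mid hi := by
      rintro y ⟨i, hi1, hi2, hi3⟩ ⟨j, hj1, hj2, hj3⟩
      exact hdisj i j (by omega) (by omega) (by omega) (by omega) (by omega) y hi3 hj3
    have hd₂ : ∀ y ∈ unionIco W mid hi, y ∉ unionIco A lo mid := by
      rintro y ⟨i, hi1, hi2, hi3⟩ ⟨j, hj1, hj2, hj3⟩
      exact hdisj i j (by omega) (by omega) (by omega) (by omega) (by omega) y hi3 hj3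
    have hp₁' : Post lo mid m₂ := hstab lo mid m₁ m₂ h1 (by omega) hp₁ fun y hy =>
      hr₂.frame y fun hy' => hd₁ y hy (hWA' y hy')
    obtain ⟨m', hr, hp⟩ := hcomb lo mid hi m₂ hlo h1 h2 hhi hmid hp₁' hp₂
    refine ⟨m', ?_, hp⟩
    have hA : ∀ y ∈ unionIco A lo mid ∪ unionIco A mid hi ∪ unionIco A lo hi,
        y ∈ unionIco A lo hi := by
      rintro y ((hy | hy) | hy)
      · exact unionIco_mono le_rfl h2.le y hy
      · exact unionIco_mono h1.le le_rfl y hy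
      · exact hy
    have hW : ∀ y ∈ unionIco W lo mid ∪ unionIco W mid hi ∪ unionIco W lo hi,
        y ∈ unionIco W lo hi := by
      rintro y ((hy | hy) | hy)
      · exact unionIco_mono le_rfl h2.le y hy
      · exact unionIco_mono h1.le le_rfl y hy
      · exact hy
    have hrun := Runs.iteFalse (a := .var 1) (b := .add (.var 0) (.lit 1)) (s₁ := leaf)
      (env := [lo, hi, e₁, e₂, e₃]) (by simpa [IExp.eval] using hlen) (by simp [IExp.cost])
      (((hr₁.call (env := [lo, hi, e₁, e₂, e₃])
          (args := [.var 0, .div (.add (.var 0) (.var 1)) (.lit 2), .var 2, .var 3, .var 4]) hP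
          (by simp [IExp.eval, hmid]) (by simp [IExp.cost])).par
        (hr₂.call (env := [lo, hi, e₁, e₂, e₃])
          (args := [.div (.add (.var 0) (.var 1)) (.lit 2), .var 1, .var 2, .var 3, .var 4]) hP
          (by simp [IExp.eval, hmid]) (by simp [IExp.cost])) hd₁ hd₂).seq hr)
    have hlen₁ : mid - lo = (hi - lo) / 2 := by omega
    have hlen₂ : hi - mid = (hi - lo) - (hi - lo) / 2 := by omega
    -- An internal node takes 4 steps (test, two calls, `comb`) and a leaf `cl + 1`. With l leaves
    -- and l - 1 internal nodes the total is l(cl + 5) - 4.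
    have hc : 1 + (1 + ((mid - lo) * (cl + 5) - 4) + (1 + ((hi - mid) * (cl + 5) - 4)) + 1) ≤
        (hi - lo) * (cl + 5) - 4 := by
      have e : hi - lo = (mid - lo) + (hi - mid) := by omega
      have e1 : cl + 5 ≤ (mid - lo) * (cl + 5) := Nat.le_mul_of_pos_left _ (by omega)
      have e2 : cl + 5 ≤ (hi - mid) * (cl + 5) := Nat.le_mul_of_pos_left _ (by omega)
      rw [e, Nat.add_mul]
      omega
    rcases hX lo hi hlo hlen hhi with ⟨F, hF, hF', hX'⟩ | hX'
    · exact ((hrun.mono (A₁ := unionIco A lo hi) hA hW hc le_rfl le_rfl).of_lines F hF hF').mono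
        (fun _ h => h) (fun _ h => h) le_rfl (by omega) hX'
    · exact hrun.mono hA hW hc (by omega) (by rw [hlen₁, hlen₂]; omega)

/-! ### Tree reduction -/

/-- Body of a procedure `f` that computes the minimum of `x` over an interval of indices, working in
the array that starts at its third parameter. -/
def reduceBody (f : ℕ) (x : RExp) : Stmt :=
  dncBody f (.store (.add (.var 2) (.var 0)) x)
    (.store (.add (.var 2) (.var 0)) (.min (.mem (.add (.var 2) (.var 0)))
      (.mem (.add (.var 2) (.div (.add (.var 0) (.var 1)) (.lit 2))))))

/-- The term at index `i` reads only from the arrays at `α` and `β`, which are disjoint from the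
scratch window. The minimum over a subinterval is kept in the scratch cell of its left end. -/
theorem Runs.reduce {k B : ℕ} (hk : 6 ≤ k) (hB : 1 ≤ B) {P : Program} {w : ℕ → ℕ → ℝ} {f : ℕ}
    {x : RExp} (hP : P.procs[f]? = some (reduceBody f x)) (hcost : x.cost ≤ 90)
    {tb e₂ e₃ α β Lo Hi : ℕ}
    (hreads : ∀ i h, ∀ y ∈ x.reads [i, h, tb, e₂, e₃], y = α + i ∨ y = β + i)
    (hlen : ∀ i h, (x.reads [i, h, tb, e₂, e₃]).length ≤ 2)
    (hα : α + Hi ≤ tb + Lo ∨ tb + Hi ≤ α + Lo) (hβ : β + Hi ≤ tb + Lo ∨ tb + Hi ≤ β + Lo)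
    (V : ℕ → ℝ) (m₀ : ℕ → ℝ)
    (hV : ∀ m : ℕ → ℝ, (∀ y, y < tb + Lo ∨ tb + Hi ≤ y → m y = m₀ y) →
      ∀ i h, Lo ≤ i → i < Hi → x.eval w [i, h, tb, e₂, e₃] m = V i)
    (hlt : Lo < Hi) {L : ℕ} (hL : Hi - Lo ≤ 2 ^ L) :
    ∃ m', Runs k B P w (reduceBody f x) [Lo, Hi, tb, e₂, e₃] m₀ m'
      {y | ∃ i, Lo ≤ i ∧ i < Hi ∧ (y = tb + i ∨ y = α + i ∨ y = β + i)}
      {y | ∃ i, Lo ≤ i ∧ i < Hi ∧ y = tb + i}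
      (6 * (Hi - Lo) - 4) (2 + 3 * L) (18 * (Hi - Lo) + 6 * B) ∧
      IsLeast (V '' Set.Ico Lo Hi) (m' (tb + Lo)) := by
  let A : ℕ → Set ℕ := fun i => {y | y = tb + i ∨ y = α + i ∨ y = β + i}
  let W : ℕ → Set ℕ := fun i => {y | y = tb + i}
  -- Up to length `B`, three arrays meet at most two lines each. Beyond, the term `-3 * B` pays for
  -- the three accesses of `comb`, so that the recurrence over halves closes.
  let X : ℕ → ℕ := fun l => if l ≤ B then 6 * B else 18 * l - 3 * B
  have hagree : ∀ m : ℕ → ℝ, (∀ y, y ∉ unionIco W Lo Hi → m y = m₀ y) →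
      ∀ y, y < tb + Lo ∨ tb + Hi ≤ y → m y = m₀ y := by
    intro m hm y hy
    refine hm y ?_
    rintro ⟨i, h1, h2, h3⟩
    have : y = tb + i := h3
    omega
  obtain ⟨m', h, hp⟩ := Runs.dnc (k := k) (B := B) (w := w) hP (e₁ := tb) (e₂ := e₂) (e₃ := e₃)
    (Lo := Lo) (Hi := Hi) m₀ A W
    (fun lo hi m => IsLeast (V '' Set.Ico lo hi) (m (tb + lo))) 1 1 (3 * B) X
    (fun i _ _ y hy => .inl hy)
    (by
      rintro i j h1 h2 h3 h4 h5 y hy hy'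
      have e : y = tb + i := hy
      have e' : y = tb + j ∨ y = α + j ∨ y = β + j := hy'
      omega)
    (by
      intro lo hi m m' hlo _ h h'
      rw [h' (tb + lo) ⟨lo, le_rfl, hlo, rfl⟩]
      exact h)
    (by
      intro i m h1 h2 hm
      refine ⟨_, (Runs.store (by omega) (by simp only [IExp.cost]; omega)).mono ?_ ?_ le_rfl le_rfl ?_,
        ?_⟩
      · rintro y (hy | hy)
        · exact .inr (hreads _ _ y hy)
        · exact .inl (by simpa [IExp.eval] using hy)
      · intro y hy
        exact (by simpa [IExp.eval] using hy : y = tb + i)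
      · simp only [X, if_pos hB]
        have := Nat.mul_le_mul_left B (Nat.add_le_add_right (hlen i (i + 1)) 1)
        omega
      · have e : Set.Ico i (i + 1) = {i} := by ext; simp; omega
        rw [e, Set.image_singleton, hV m (hagree m hm) i (i + 1) h1 h2]
        simp [IExp.eval])
    (by
      intro lo mid hi m h1 h2 h3 h4 hmid hp hp'
      refine ⟨_, (Runs.store (by omega) (by simp [IExp.cost, RExp.cost])).mono ?_ ?_ le_rfl le_rfl ?_,
        ?_⟩
      · intro y hy
        simp only [RExp.reads, IExp.eval, List.getD_cons_zero, List.getD_cons_succ, Set.mem_ofPred_eq,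
          List.mem_append, List.mem_singleton, ← hmid] at hy
        rcases hy with (rfl | rfl) | rfl
        · exact ⟨lo, le_rfl, by omega, .inl rfl⟩
        · exact ⟨mid, by omega, by omega, .inl rfl⟩
        · exact ⟨lo, le_rfl, by omega, .inl rfl⟩
      · intro y hy
        exact ⟨lo, le_rfl, by omega, (by simpa [IExp.eval] using hy : y = tb + lo)⟩
      · simp [RExp.reads, mul_comm]
      · have e : Set.Ico lo hi = Set.Ico lo mid ∪ Set.Ico mid hi :=
          (Set.Ico_union_Ico_eq_Ico h2.le h3.le).symm
        simp only [e, Set.image_union, RExp.eval, IExp.eval, List.getD_cons_zero,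
          List.getD_cons_succ, ← hmid, Function.update_self]
        exact hp.union hp')
    (by
      intro lo hi h1 h2 h3
      by_cases hl : hi - lo ≤ B
      · left
        have hc : ∀ b, (Finset.Icc ((b + lo) / B) ((b + (hi - 1)) / B)).card ≤ 2 := fun b => by
          have := card_lines_le hB (b + lo) (b + (hi - 1))
          rwa [Nat.div_eq_of_lt (by omega : b + (hi - 1) - (b + lo) < B)] at this
        have hm : ∀ b i, lo ≤ i → i < hi →
            (b + i) / B ∈ Finset.Icc ((b + lo) / B) ((b + (hi - 1)) / B) := fun b i h1 h2 =>
          Finset.mem_Icc.2 ⟨Nat.div_le_div_right (by omega), Nat.div_le_div_right (by omega)⟩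
        let F := Finset.Icc ((tb + lo) / B) ((tb + (hi - 1)) / B) ∪
          (Finset.Icc ((α + lo) / B) ((α + (hi - 1)) / B) ∪
            Finset.Icc ((β + lo) / B) ((β + (hi - 1)) / B))
        have hF : F.card ≤ 6 := by
          have h1 := Finset.card_union_le (Finset.Icc ((tb + lo) / B) ((tb + (hi - 1)) / B))
            (Finset.Icc ((α + lo) / B) ((α + (hi - 1)) / B) ∪
            Finset.Icc ((β + lo) / B) ((β + (hi - 1)) / B))
          have h2 := Finset.card_union_le (Finset.Icc ((α + lo) / B) ((α + (hi - 1)) / B))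
            (Finset.Icc ((β + lo) / B) ((β + (hi - 1)) / B))
          have := hc tb
          have := hc α
          have := hc β
          change Finset.card (_ ∪ (_ ∪ _)) ≤ 6
          omega
        refine ⟨F, hF.trans hk, ?_, ?_⟩
        · rintro y ⟨i, hi1, hi2, rfl | rfl | rfl⟩
          · exact Finset.mem_union_left _ (hm _ _ hi1 hi2)
          · exact Finset.mem_union_right _ (Finset.mem_union_left _ (hm _ _ hi1 hi2))
          · exact Finset.mem_union_right _ (Finset.mem_union_right _ (hm _ _ hi1 hi2))
        · simp only [X, if_pos hl]
          rw [mul_comm]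
          exact Nat.mul_le_mul_right B hF
      · right
        simp only [X]
        split_ifs <;> omega)
    L Lo Hi m₀ le_rfl hlt le_rfl hL (fun _ _ => rfl)
  refine ⟨m', h.mono ?_ ?_ (by omega) (by omega) ?_, hp⟩
  · rintro y ⟨i, h1, h2, h3⟩
    exact ⟨i, h1, h2, h3⟩
  · rintro y ⟨i, h1, h2, h3⟩
    exact ⟨i, h1, h2, h3⟩
  · simp only [X]
    split_ifs <;> omega

/-! ### The program

With `N = n + 1`, the cells are arranged in rows of length `N`: the values `D`, a row of values `E`,
and for each `j ≤ n` a scratch row and a row of distances to `j`. -/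

/-- First cell of the scratch row of `j`. -/
def tRow (n j : ℕ) : ℕ := (2 + j) * (n + 1)

/-- First cell of the row of distances to `j`. -/
def rRow (n j : ℕ) : ℕ := (2 + (n + 1 + j)) * (n + 1)

/-- Index expression for `tRow`; the size `n` is parameter `2`. -/
def tRowExp (j : IExp) : IExp := .mul (.add (.lit 2) j) (.add (.var 2) (.lit 1))

/-- Index expression for `rRow`; the size `n` is parameter `2`. -/
def rRowExp (j : IExp) : IExp :=
  .mul (.add (.lit 2) (.add (.add (.var 2) (.lit 1)) j)) (.add (.var 2) (.lit 1))

/-- Parameters `n`, `s`: find the block size, then treat all rows and all blocks. -/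
def rootBody : Stmt :=
  .ite (.ile (.var 0) (.mul (.var 1) (.var 1)))
    (.comp .seq (.call 2 [.lit 0, .add (.var 0) (.lit 1), .var 0, .var 1, .lit 0])
      (.call 3 [.lit 1, .var 1, .var 0]))
    (.call 1 [.var 0, .add (.var 1) (.lit 1)])

/-- Parameters `lo`, `hi`, `n`, `s`: the rows of distances to `lo ≤ j < hi`, in parallel. -/
def rowsBody : Stmt :=
  dncBody 2 (.comp .seq (.store (.add (rRowExp (.var 0)) (.var 0)) (.lit 0))
    (.call 4 [.var 0, .var 0, .var 2, .var 3])) .skip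

/-- Last index plus one of the block that starts at parameter `0`. -/
def blockEndExp : IExp :=
  .sub (.add (.var 0) (.var 1)) (.sub (.add (.var 0) (.var 1)) (.add (.var 2) (.lit 1)))

/-- Parameters `a`, `s`, `n`: the blocks from the one that starts at `a`. -/
def blocksBody : Stmt :=
  .ite (.ile (.add (.var 2) (.lit 1)) (.var 0)) .skip
    (.comp .seq (.call 5 [.var 0, blockEndExp, .var 2, .var 0, .lit 0])
      (.comp .seq (.call 6 [.var 0, blockEndExp, .var 2, .var 0, .lit 0])
        (.call 3 [.add (.var 0) (.var 1), .var 1, .var 2])))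

/-- Parameters `i`, `j`, `n`, `s`: the distances to `j` from the vertices of its block below `i`. -/
def rowBody : Stmt :=
  .ite (.ile (.var 0) (.add (.lit 1) (.mul (.div (.sub (.var 1) (.lit 1)) (.var 3)) (.var 3)))) .skip
    (.comp .seq (.call 7 [.var 0, .add (.var 1) (.lit 1), tRowExp (.var 1), rRowExp (.var 1),
        .sub (.var 0) (.lit 1)])
      (.comp .seq (.store (.add (rRowExp (.var 1)) (.sub (.var 0) (.lit 1)))
          (.mem (.add (tRowExp (.var 1)) (.var 0))))
        (.call 4 [.sub (.var 0) (.lit 1), .var 1, .var 2, .var 3])))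

/-- Parameters `lo`, `hi`, `n`, `a`: the contributions of the vertices below `a` to `lo ≤ j < hi`. -/
def externalBody : Stmt :=
  dncBody 5 (.comp .seq (.call 8 [.lit 0, .var 3, tRowExp (.var 0), .lit 0, .var 0])
    (.store (.add (.add (.var 2) (.lit 1)) (.var 0)) (.mem (tRowExp (.var 0))))) .skip

/-- Parameters `lo`, `hi`, `n`, `a`: the values of `lo ≤ j < hi`. -/
def valuesBody : Stmt :=
  dncBody 6 (.comp .seq (.call 9 [.var 3, .add (.var 0) (.lit 1), tRowExp (.var 0),
      rRowExp (.var 0), .add (.var 2) (.lit 1)])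
    (.store (.var 0) (.mem (.add (tRowExp (.var 0)) (.var 3))))) .skip

/-- In the three reduction terms, parameter 0 is the running index, and parameters 3 and 4 carry the
base addresses and fixed indices that the term needs. -/
def rowTerm : RExp := .add (.weight (.var 4) (.var 0)) (.mem (.add (.var 3) (.var 0)))

def externalTerm : RExp := .add (.mem (.add (.var 3) (.var 0))) (.weight (.var 0) (.var 4))

def valueTerm : RExp := .add (.mem (.add (.var 4) (.var 0))) (.mem (.add (.var 3) (.var 0)))

/-- Procedure numbers in calls are positions in this list. There are no fire rules because no fire
construct occurs. -/
def lwsProgram : Program where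
  procs := [.call 1 [.var 0, .lit 1], rootBody, rowsBody, blocksBody, rowBody, externalBody,
    valuesBody, reduceBody 7 rowTerm, reduceBody 8 externalTerm, reduceBody 9 valueTerm]
  rules := []

theorem le_tRow (n j : ℕ) : 2 * (n + 1) ≤ tRow n j := Nat.mul_le_mul_right _ (by omega)

theorem tRow_add_le {n j j' : ℕ} (h : j < j') : tRow n j + (n + 1) ≤ tRow n j' := by
  unfold tRow; nlinarith

theorem rRow_add_le {n j j' : ℕ} (h : j < j') : rRow n j + (n + 1) ≤ rRow n j' := by
  unfold rRow; nlinarith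

theorem tRow_add_le_rRow {n j : ℕ} (h : j ≤ n) (j' : ℕ) : tRow n j + (n + 1) ≤ rRow n j' := by
  unfold tRow rRow; nlinarith

theorem rRow_add_le_of_le {n j : ℕ} (h : j ≤ n) : rRow n j + (n + 1) ≤ (2 * n + 4) * (n + 1) := by
  unfold rRow; nlinarith

/-! ### Rows of distances -/

/-- `ρ i` is the length of a shortest path from `i` to `j`, for `a ≤ i ≤ j`. -/
def IsRow (w : ℕ → ℕ → ℝ) (j a : ℕ) (ρ : ℕ → ℝ) : Prop :=
  ρ j = 0 ∧ ∀ i, a ≤ i → i < j → IsLeast ((fun p => w i p + ρ p) '' Set.Ico (i + 1) (j + 1)) (ρ i)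

/-- The alternative `p = j` is needed because `a` may exceed `j`: the block start of `j = 0` is 1.
-/
theorem IsRow.congr {w : ℕ → ℕ → ℝ} {j a : ℕ} {ρ ρ' : ℕ → ℝ} (h : IsRow w j a ρ)
    (h' : ∀ p, a ≤ p ∨ p = j → p ≤ j → ρ' p = ρ p) : IsRow w j a ρ' := by
  refine ⟨by rw [h' j (.inr rfl) le_rfl, h.1], fun i hi hij => ?_⟩
  rw [h' i (.inl hi) hij.le]
  have e : (fun p => w i p + ρ' p) '' Set.Ico (i + 1) (j + 1) =
      (fun p => w i p + ρ p) '' Set.Ico (i + 1) (j + 1) := by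
    refine Set.image_congr fun p hp => ?_
    rw [h' p (.inl (by have := hp.1; omega)) (by have := hp.2; omega)]
  rw [e]
  exact h.2 i hi hij

/-- Start of the block of `j`. -/
def blockStart (s j : ℕ) : ℕ := 1 + (j - 1) / s * s

theorem lt_blockStart_add {s : ℕ} (hs : 1 ≤ s) (j : ℕ) : j < blockStart s j + s := by
  have h1 := Nat.div_add_mod (j - 1) s
  have h2 := Nat.mod_lt (j - 1) hs
  rw [mul_comm] at h1
  unfold blockStart
  omega

theorem Runs.copy {k B : ℕ} (hk : 1 ≤ k) {P : Program} {w : ℕ → ℕ → ℝ} {a b : IExp} {env : List ℕ}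
    {m : ℕ → ℝ} {a' b' : ℕ} (ha : a.eval env = a') (hb : b.eval env = b')
    (hcost : a.cost + b.cost + 2 ≤ 100) :
    Runs k B P w (.store a (.mem b)) env m (Function.update m a' (m b'))
      {y | y = b' ∨ y = a'} {a'} 1 1 (2 * B) := by
  subst ha hb
  refine (Runs.store hk (by simp only [RExp.cost]; omega)).mono ?_ (fun _ h => h) le_rfl le_rfl ?_
  · simp [RExp.reads]
  · simp [RExp.reads, mul_comm]

/-- The cells used to compute the distances to `j`. -/
def rowCells (n s j : ℕ) : Set ℕ :=
  {y | ∃ p, p ≤ j ∧ j < p + s ∧ (y = tRow n j + p ∨ y = rRow n j + p)}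

/-- Each recursive call extends the row by one vertex to the left: its distance is a minimum over
the first edge, followed by a distance already known. The block has at most `s` vertices, which
bounds both the number of rounds and the length of each reduction. -/
theorem runs_rowBody {k B : ℕ} (hk : 6 ≤ k) (hB : 1 ≤ B) (w : ℕ → ℕ → ℝ) {n s j L : ℕ} (hs : 1 ≤ s)
    (hj : j ≤ n) (hL : s ≤ 2 ^ L) (i : ℕ) : ∀ m : ℕ → ℝ, i ≤ j →
    (IsRow w j i fun p => m (rRow n j + p)) →
    ∃ m', Runs k B lwsProgram w rowBody [i, j, n, s] m m' (rowCells n s j) (rowCells n s j)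
      ((i - blockStart s j) * (6 * s) + 2) ((i - blockStart s j) * (6 + 3 * L) + 2)
      ((i - blockStart s j) * (18 * s + 8 * B)) ∧
      IsRow w j (blockStart s j) fun p => m' (rRow n j + p) := by
  have hlt := lt_blockStart_add hs j
  have hsep := tRow_add_le_rRow hj j
  have skip : ∀ i m, i ≤ blockStart s j → (IsRow w j i fun p => m (rRow n j + p)) →
      ∃ m', Runs k B lwsProgram w rowBody [i, j, n, s] m m' (rowCells n s j) (rowCells n s j)
      ((i - blockStart s j) * (6 * s) + 2) ((i - blockStart s j) * (6 + 3 * L) + 2)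
      ((i - blockStart s j) * (18 * s + 8 * B)) ∧
      IsRow w j (blockStart s j) fun p => m' (rRow n j + p) := by
    intro i m hi hm
    refine ⟨m, (Runs.iteTrue (by simpa [IExp.eval, blockStart] using hi) (by simp [IExp.cost])
      Runs.skip).mono (fun _ h => h.elim) (fun _ h => h.elim) ?_ ?_ ?_, hm.1, fun i' h => hm.2 i' (hi.trans h)⟩ <;>
      simp [Nat.sub_eq_zero_of_le hi]
  induction i with
  | zero => exact fun m _ hm => skip 0 m (Nat.zero_le _) hm
  | succ i ih =>
    intro m hij hm
    by_cases hi : i + 1 ≤ blockStart s j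
    · exact skip (i + 1) m hi hm
    obtain ⟨m₁, hr, hp⟩ := Runs.reduce hk hB (P := lwsProgram) (w := w) (f := 7) (x := rowTerm) rfl
      (by simp [rowTerm, RExp.cost, IExp.cost]) (tb := tRow n j) (e₂ := rRow n j) (e₃ := i)
      (α := rRow n j) (β := rRow n j) (Lo := i + 1) (Hi := j + 1)
      (by simp [rowTerm, RExp.reads, IExp.eval]) (by simp [rowTerm, RExp.reads]) (by omega) (by omega)
      (fun p => w i p + m (rRow n j + p)) m
      (by
        intro m₁ hm₁ p h h1 h2
        simp only [rowTerm, RExp.eval, IExp.eval, List.getD_cons_zero, List.getD_cons_succ]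
        rw [hm₁ (rRow n j + p) (by omega)])
      (by omega) (L := L) (by omega)
    have hm₂ : IsRow w j i fun p => Function.update m₁ (rRow n j + i) (m₁ (tRow n j + (i + 1)))
        (rRow n j + p) := by
      have hne : ∀ p, p ≠ i → Function.update m₁ (rRow n j + i) (m₁ (tRow n j + (i + 1)))
          (rRow n j + p) = m (rRow n j + p) := by
        intro p hpi
        rw [Function.update_of_ne (by omega)]
        refine hr.frame _ ?_
        rintro ⟨q, h1, h2, h3⟩
        omega
      refine ⟨(hne j (by omega)).trans hm.1, fun i' h1 h2 => ?_⟩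
      have e : (fun p => w i' p + Function.update m₁ (rRow n j + i) (m₁ (tRow n j + (i + 1)))
          (rRow n j + p)) '' Set.Ico (i' + 1) (j + 1) =
          (fun p => w i' p + m (rRow n j + p)) '' Set.Ico (i' + 1) (j + 1) := by
        refine Set.image_congr fun p hp => ?_
        rw [hne p (by have := hp.1; omega)]
      rw [e]
      rcases h1.eq_or_lt with rfl | h1
      · simpa using hp
      · simp only [hne i' (by omega)]
        exact hm.2 i' h1 h2
    obtain ⟨m', hr', hp'⟩ := ih _ (by omega) hm₂
    refine ⟨m', ?_, hp'⟩
    refine (Runs.iteFalse (by simp [IExp.eval]; simp [blockStart] at hi; omega) (by simp [IExp.cost])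
      ((hr.call rfl (by simp [IExp.eval, tRowExp, rRowExp, tRow, rRow])
        (by simp [IExp.cost, tRowExp, rRowExp])).seq
      ((Runs.copy (by omega) (a' := rRow n j + i) (b' := tRow n j + (i + 1))
        (by simp [IExp.eval, rRowExp, rRow]) (by simp [IExp.eval, tRowExp, tRow])
        (by simp [IExp.cost, tRowExp, rRowExp])).seq
      (hr'.call (args := [.sub (.var 0) (.lit 1), .var 1, .var 2, .var 3]) rfl
        (by simp [IExp.eval]) (by simp [IExp.cost]))))).mono ?_ ?_ ?_ ?_ ?_
    · rintro y (⟨p, h1, h2, h3⟩ | (rfl | rfl) | hy)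
      · exact ⟨p, by omega, by omega, by omega⟩
      · exact ⟨i + 1, by omega, by omega, .inl rfl⟩
      · exact ⟨i, by omega, by omega, .inr rfl⟩
      · exact hy
    · rintro y (⟨p, h1, h2, h3⟩ | hy | hy)
      · exact ⟨p, by omega, by omega, by omega⟩
      · exact ⟨i, by omega, by omega, .inr hy⟩
      · exact hy
    · have e : i + 1 - blockStart s j = (i - blockStart s j) + 1 := by omega
      rw [e, Nat.add_mul]
      omega
    · have e : i + 1 - blockStart s j = (i - blockStart s j) + 1 := by omega
      rw [e, Nat.add_mul]
      omega
    · have e : i + 1 - blockStart s j = (i - blockStart s j) + 1 := by omega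
      rw [e, Nat.add_mul]
      omega

/-- Index loops: `leaf` runs in parallel on the indices `Lo ≤ i < Hi`. -/
theorem Runs.parFor {k B : ℕ} {P : Program} {w : ℕ → ℕ → ℝ} {f : ℕ} {leaf : Stmt}
    (hP : P.procs[f]? = some (dncBody f leaf .skip)) {e₁ e₂ e₃ Lo Hi : ℕ} (hlt : Lo < Hi)
    (m₀ : ℕ → ℝ) (A W : ℕ → Set ℕ) (Post : ℕ → (ℕ → ℝ) → Prop) (cl dl xl : ℕ)
    (hWA : ∀ i, Lo ≤ i → i < Hi → ∀ y ∈ W i, y ∈ A i)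
    (hdisj : ∀ i j, Lo ≤ i → i < Hi → Lo ≤ j → j < Hi → i ≠ j → ∀ y ∈ W i, y ∉ A j)
    (hstab : ∀ i m m', i < Hi → Post i m → (∀ y ∈ W i, m' y = m y) → Post i m')
    (hleaf : ∀ i m, Lo ≤ i → i < Hi → (∀ y, y ∉ unionIco W Lo Hi → m y = m₀ y) →
      ∃ m', Runs k B P w leaf [i, i + 1, e₁, e₂, e₃] m m' (A i) (W i) cl dl xl ∧ Post i m')
    {L : ℕ} (hL : Hi - Lo ≤ 2 ^ L) :
    ∃ m', Runs k B P w (dncBody f leaf .skip) [Lo, Hi, e₁, e₂, e₃] m₀ m' (unionIco A Lo Hi)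
      (unionIco W Lo Hi) ((Hi - Lo) * (cl + 5)) (dl + 1 + 3 * L) ((Hi - Lo) * xl) ∧
      ∀ i, Lo ≤ i → i < Hi → Post i m' := by
  obtain ⟨m', h, hp⟩ := Runs.dnc (k := k) (B := B) (w := w) hP (e₁ := e₁) (e₂ := e₂) (e₃ := e₃)
    (Lo := Lo) (Hi := Hi) m₀ A W (fun lo hi m => ∀ i, lo ≤ i → i < hi → Post i m) cl dl 0
    (fun l => l * xl) hWA hdisj
    (fun lo hi m m' _ hhi h h' i h1 h2 =>
      hstab i m m' (by omega) (h i h1 h2) fun y hy => h' y ⟨i, h1, h2, hy⟩)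
    (fun i m h1 h2 hm => by
      obtain ⟨m', h, hp⟩ := hleaf i m h1 h2 hm
      refine ⟨m', by simpa using h, fun i' h1' h2' => ?_⟩
      obtain rfl : i' = i := by omega
      exact hp)
    (fun lo mid hi m _ _ _ _ _ hp hp' =>
      ⟨m, Runs.skip.mono (fun _ h => h.elim) (fun _ h => h.elim) le_rfl le_rfl le_rfl,
        fun i h1 h2 => (lt_or_ge i mid).elim (hp i h1) fun h => hp' i h h2⟩)
    (fun lo hi _ _ _ => .inr (by
      rw [add_zero, ← Nat.add_mul]
      exact Nat.mul_le_mul_right _ (by omega)))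
    L Lo Hi m₀ le_rfl hlt le_rfl hL (fun _ _ => rfl)
  exact ⟨m', h.mono (fun _ h => h) (fun _ h => h) (Nat.sub_le _ _) le_rfl le_rfl, hp⟩

/-- For short rows the overhead of `8 * B` in each of up to `s` rounds would be too large; instead,
the two windows of `s` cells are loaded once. -/
theorem Runs.of_rowCells {k B : ℕ} (hB : 1 ≤ B) {P : Program} {w : ℕ → ℕ → ℝ} {S : Stmt}
    {env : List ℕ} {m m' : ℕ → ℝ} {W : Set ℕ} {c d x n s j : ℕ}
    (hfit : 2 * (s / B + 2) ≤ k) (h : Runs k B P w S env m m' (rowCells n s j) W c d x) :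
    Runs k B P w S env m m' (rowCells n s j) W c d (2 * s + 4 * B) := by
  have hc : ∀ b, (Finset.Icc ((b + (j + 1 - s)) / B) ((b + j) / B)).card ≤ s / B + 2 := fun b =>
    (card_lines_le hB _ _).trans (Nat.add_le_add_right (Nat.div_le_div_right (by omega)) 2)
  have hm : ∀ b p, p ≤ j → j < p + s →
      (b + p) / B ∈ Finset.Icc ((b + (j + 1 - s)) / B) ((b + j) / B) := fun b p h1 h2 =>
    Finset.mem_Icc.2 ⟨Nat.div_le_div_right (by omega), Nat.div_le_div_right (by omega)⟩
  have hF := (Finset.card_union_le _ _).trans (Nat.add_le_add (hc (tRow n j)) (hc (rRow n j)))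
  refine (h.of_lines _ (hF.trans (by omega)) ?_).mono (fun _ h => h) (fun _ h => h) le_rfl le_rfl ?_
  · rintro y ⟨p, h1, h2, rfl | rfl⟩
    · exact Finset.mem_union_left _ (hm _ _ h1 h2)
    · exact Finset.mem_union_right _ (hm _ _ h1 h2)
  · have := Nat.mul_le_mul_left B hF
    have := Nat.mul_div_le s B
    nlinarith

theorem runs_rowsBody {k B : ℕ} (hk : 6 ≤ k) (hB : 1 ≤ B) (w : ℕ → ℕ → ℝ) {n s L : ℕ} (hs : 1 ≤ s)
    (hL : s ≤ 2 ^ L) (hL' : n + 1 ≤ 2 ^ L) (m : ℕ → ℝ) :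
    ∃ m', Runs k B lwsProgram w rowsBody [0, n + 1, n, s, 0] m m'
      {y | 2 * (n + 1) ≤ y ∧ y < (2 * n + 4) * (n + 1)}
      {y | 2 * (n + 1) ≤ y ∧ y < (2 * n + 4) * (n + 1)}
      ((n + 1) * (6 * (s * s) + 9)) (s * (6 + 3 * L) + 5 + 3 * L) ((n + 1) * (26 * (s * s) + 5 * B)) ∧
      ∀ j, j ≤ n → IsRow w j (blockStart s j) fun p => m' (rRow n j + p) := by
  have hsub : ∀ y ∈ unionIco (rowCells n s) 0 (n + 1),
      2 * (n + 1) ≤ y ∧ y < (2 * n + 4) * (n + 1) := by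
    rintro y ⟨j, -, hj, p, h1, -, h2⟩
    have := le_tRow n j
    have := tRow_add_le_rRow (show j ≤ n by omega) j
    have := rRow_add_le_of_le (show j ≤ n by omega)
    omega
  obtain ⟨m', h, hp⟩ := Runs.parFor (k := k) (B := B) (P := lwsProgram) (w := w) (f := 2) rfl
    (e₁ := n) (e₂ := s) (e₃ := 0) (Nat.succ_pos n) m (rowCells n s) (rowCells n s)
    (fun j m => IsRow w j (blockStart s j) fun p => m (rRow n j + p))
    (6 * (s * s) + 4) (s * (6 + 3 * L) + 4) (26 * (s * s) + 5 * B)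
    (fun _ _ _ _ h => h)
    (by
      rintro i j - hi - hj hij y ⟨p, h1, -, h2⟩ ⟨q, h3, -, h4⟩
      have := tRow_add_le_rRow (show i ≤ n by omega) j
      have := tRow_add_le_rRow (show j ≤ n by omega) i
      rcases hij.lt_or_gt with hij | hij
      · have := tRow_add_le (n := n) hij
        have := rRow_add_le (n := n) hij
        omega
      · have := tRow_add_le (n := n) hij
        have := rRow_add_le (n := n) hij
        omega)
    (by
      intro j m m' _ h h'
      refine h.congr fun p hp hpj => h' _ ⟨p, hpj, ?_, .inr rfl⟩
      have := lt_blockStart_add hs j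
      omega)
    (by
      intro j m _ hj _
      have hlt := lt_blockStart_add hs j
      obtain ⟨m', h, hp⟩ := runs_rowBody hk hB w hs (show j ≤ n by omega) hL j
        (Function.update m (rRow n j + j) 0) le_rfl
        ⟨by simp, fun i h1 h2 => absurd h1 (by omega)⟩
      have hsj : j - blockStart s j ≤ s := by omega
      have hx : Runs k B lwsProgram w rowBody [j, j, n, s] (Function.update m (rRow n j + j) 0) m'
          (rowCells n s j) (rowCells n s j) (6 * (s * s) + 2) (s * (6 + 3 * L) + 2)
          (26 * (s * s) + 4 * B) := by
        have hc : (j - blockStart s j) * (6 * s) + 2 ≤ 6 * (s * s) + 2 := by nlinarith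
        have hd : (j - blockStart s j) * (6 + 3 * L) + 2 ≤ s * (6 + 3 * L) + 2 :=
          Nat.add_le_add_right (Nat.mul_le_mul_right _ hsj) 2
        -- If `s < B`, the footprint of the row is at most four lines. Otherwise `8 * B ≤ 8 * s`,
        -- and the sum over at most `s` rounds is at most `26 * (s * s)`.
        rcases lt_or_ge s B with hsB | hBs
        · have hfit : 2 * (s / B + 2) ≤ k := by rw [Nat.div_eq_of_lt hsB]; omega
          exact (h.of_rowCells hB hfit).mono (fun _ h => h) (fun _ h => h) hc hd (by nlinarith)
        · refine h.mono (fun _ h => h) (fun _ h => h) hc hd ?_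
          have := Nat.mul_le_mul hsj (show 18 * s + 8 * B ≤ 26 * s by omega)
          nlinarith
      refine ⟨m', ((Runs.store (a := .add (rRowExp (.var 0)) (.var 0)) (x := .lit 0)
        (env := [j, j + 1, n, s, 0]) (m := m) (by omega)
        (by simp [IExp.cost, RExp.cost, rRowExp])).seq (Runs.call (env' := [j, j, n, s]) rfl
          (by simp [IExp.eval]) (by simp [IExp.cost])
          (by simpa [IExp.eval, RExp.eval, rRowExp, rRow] using hx))).mono ?_ ?_ ?_ ?_ ?_, hp⟩
      · rintro y ((hy | hy) | hy)
        · simp [RExp.reads] at hy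
        · exact ⟨j, le_rfl, by omega, .inr (by simpa [IExp.eval, rRowExp, rRow] using hy)⟩
        · exact hy
      · rintro y (hy | hy)
        · exact ⟨j, le_rfl, by omega, .inr (by simpa [IExp.eval, rRowExp, rRow] using hy)⟩
        · exact hy
      · omega
      · omega
      · simp only [RExp.reads, List.length_nil]
        omega)
    (L := L) (by omega)
  exact ⟨m', h.mono hsub hsub (by simp) (by omega) (by simp), fun j hj => hp j (Nat.zero_le _) (by omega)⟩

/-! ### Blocks -/

/-- Task `j` reads `D` only below `a` and writes its scratch row and `E[j]`, so the tasks are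
independent. -/
theorem runs_externalBody {k B : ℕ} (hk : 6 ≤ k) (hB : 1 ≤ B) (w : ℕ → ℕ → ℝ) {n a b L : ℕ}
    (ha : 1 ≤ a) (hab : a < b) (hb : b ≤ n + 1) (hL : n + 1 ≤ 2 ^ L) (m : ℕ → ℝ) :
    ∃ m', Runs k B lwsProgram w externalBody [a, b, n, a, 0] m m'
      {y | y < (2 * n + 4) * (n + 1)} {y | n + 1 ≤ y ∧ y < rRow n 0}
      ((b - a) * (6 * (n + 1) + 5)) (5 + 6 * L) ((b - a) * (18 * (n + 1) + 8 * B)) ∧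
      ∀ j, a ≤ j → j < b → IsLeast ((fun i => m i + w i j) '' Set.Ico 0 a) (m' (n + 1 + j)) := by
  let W : ℕ → Set ℕ := fun j => {y | y = n + 1 + j ∨ ∃ p, p ≤ n ∧ y = tRow n j + p}
  let A : ℕ → Set ℕ := fun j => {y | y < a ∨ y ∈ W j}
  have hsub : ∀ y ∈ unionIco W a b, n + 1 ≤ y ∧ y < rRow n 0 := by
    rintro y ⟨j, h1, h2, rfl | ⟨p, h3, rfl⟩⟩
    · have := le_tRow n j
      have := tRow_add_le_rRow (show j ≤ n by omega) 0
      omega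
    · have := le_tRow n j
      have := tRow_add_le_rRow (show j ≤ n by omega) 0
      omega
  obtain ⟨m', h, hp⟩ := Runs.parFor (k := k) (B := B) (P := lwsProgram) (w := w) (f := 5) rfl
    (e₁ := n) (e₂ := a) (e₃ := 0) hab m A W
    (fun j m' => IsLeast ((fun i => m i + w i j) '' Set.Ico 0 a) (m' (n + 1 + j)))
    (6 * (n + 1)) (4 + 3 * L) (18 * (n + 1) + 8 * B)
    (fun _ _ _ _ h => .inr h)
    (by
      intro i j h1 h2 h3 h4 hij y hy hy'
      have := le_tRow n i
      have := le_tRow n j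
      have hor : tRow n i + (n + 1) ≤ tRow n j ∨ tRow n j + (n + 1) ≤ tRow n i :=
        hij.lt_or_gt.imp (fun h => tRow_add_le h) fun h => tRow_add_le h
      rcases hy with rfl | ⟨p, hp, rfl⟩ <;> rcases hy' with hy' | hy' | ⟨q, hq, hy'⟩ <;> omega)
    (by
      intro j m₁ m₂ _ h h'
      rw [h' _ (.inl rfl)]
      exact h)
    (by
      intro j m₁ h1 h2 hm₁
      have hT := le_tRow n j
      have hT' := tRow_add_le_rRow (show j ≤ n by omega) 0
      obtain ⟨m₂, hr, hp⟩ := Runs.reduce hk hB (P := lwsProgram) (w := w) (f := 8)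
        (x := externalTerm) rfl (by simp [externalTerm, RExp.cost, IExp.cost]) (tb := tRow n j)
        (e₂ := 0) (e₃ := j) (α := 0) (β := 0) (Lo := 0) (Hi := a)
        (by simp [externalTerm, RExp.reads, IExp.eval]) (by simp [externalTerm, RExp.reads])
        (by omega) (by omega) (fun i => m i + w i j) m₁
        (by
          intro m₂ hm₂ i h _ hi
          simp only [externalTerm, RExp.eval, IExp.eval, List.getD_cons_zero, List.getD_cons_succ,
            zero_add]
          rw [hm₂ i (by omega), hm₁ i fun hy => by have := (hsub i hy).1; omega])
        (by omega) (L := L) (by omega)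
      refine ⟨_, ((hr.call rfl (by simp [IExp.eval, tRowExp, tRow])
        (by simp [IExp.cost, tRowExp])).seq
        (Runs.copy (by omega) (a' := n + 1 + j) (b' := tRow n j + 0)
          (by simp [IExp.eval]) (by simp [IExp.eval, tRowExp, tRow])
          (by simp [IExp.cost, tRowExp]))).mono ?_ ?_ (by omega) (by omega) (by omega), ?_⟩
      · rintro y (⟨p, h1, h2, rfl | rfl | rfl⟩ | rfl | rfl)
        · exact .inr (.inr ⟨p, by omega, rfl⟩)
        · exact .inl (by omega)
        · exact .inl (by omega)
        · exact .inr (.inr ⟨0, by omega, rfl⟩)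
        · exact .inr (.inl rfl)
      · rintro y (⟨p, h1, h2, rfl⟩ | rfl)
        · exact .inr ⟨p, by omega, rfl⟩
        · exact .inl rfl
      · simpa using hp)
    (L := L) (by omega)
  refine ⟨m', h.mono ?_ hsub (by omega) (by omega) le_rfl, hp⟩
  have := rRow_add_le_of_le (Nat.zero_le n)
  rintro y ⟨j, h1, h2, h3 | h3⟩
  · have := le_tRow n j
    have := tRow_add_le_rRow (show j ≤ n by omega) 0
    exact (show y < _ by omega)
  · have := (hsub y ⟨j, h1, h2, h3⟩).2
    exact (show y < _ by omega)

/-- The terms involve `E` and the rows of distances but no value `D`, so a whole block of `D` is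
produced in parallel. -/
theorem runs_valuesBody {k B : ℕ} (hk : 6 ≤ k) (hB : 1 ≤ B) (w : ℕ → ℕ → ℝ) {n a b L : ℕ}
    (hab : a < b) (hb : b ≤ n + 1) (hL : n + 1 ≤ 2 ^ L) (m : ℕ → ℝ) :
    ∃ m', Runs k B lwsProgram w valuesBody [a, b, n, a, 0] m m'
      {y | y < (2 * n + 4) * (n + 1)} {y | (a ≤ y ∧ y < b) ∨ (2 * (n + 1) ≤ y ∧ y < rRow n 0)}
      ((b - a) * (6 * (n + 1) + 5)) (5 + 6 * L) ((b - a) * (18 * (n + 1) + 8 * B)) ∧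
      ∀ j, a ≤ j → j < b →
        IsLeast ((fun p => m (n + 1 + p) + m (rRow n j + p)) '' Set.Ico a (j + 1)) (m' j) := by
  let W : ℕ → Set ℕ := fun j => {y | y = j ∨ ∃ p, p ≤ n ∧ y = tRow n j + p}
  let A : ℕ → Set ℕ := fun j =>
    {y | (n + 1 ≤ y ∧ y < 2 * (n + 1)) ∨ (rRow n 0 ≤ y ∧ y < (2 * n + 4) * (n + 1)) ∨ y ∈ W j}
  have hR : ∀ j, rRow n 0 ≤ rRow n j := fun j => Nat.mul_le_mul_right _ (by omega)
  have hsub : ∀ y ∈ unionIco W a b, (a ≤ y ∧ y < b) ∨ (2 * (n + 1) ≤ y ∧ y < rRow n 0) := by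
    rintro y ⟨j, h1, h2, rfl | ⟨p, h3, rfl⟩⟩
    · omega
    · have := le_tRow n j
      have := tRow_add_le_rRow (show j ≤ n by omega) 0
      omega
  obtain ⟨m', h, hp⟩ := Runs.parFor (k := k) (B := B) (P := lwsProgram) (w := w) (f := 6) rfl
    (e₁ := n) (e₂ := a) (e₃ := 0) hab m A W
    (fun j m' => IsLeast ((fun p => m (n + 1 + p) + m (rRow n j + p)) '' Set.Ico a (j + 1)) (m' j))
    (6 * (n + 1)) (4 + 3 * L) (18 * (n + 1) + 8 * B)
    (fun _ _ _ _ h => .inr (.inr h))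
    (by
      intro i j h1 h2 h3 h4 hij y hy hy'
      have := le_tRow n i
      have := le_tRow n j
      have := tRow_add_le_rRow (show i ≤ n by omega) 0
      have := tRow_add_le_rRow (show j ≤ n by omega) 0
      have hor : tRow n i + (n + 1) ≤ tRow n j ∨ tRow n j + (n + 1) ≤ tRow n i :=
        hij.lt_or_gt.imp (fun h => tRow_add_le h) fun h => tRow_add_le h
      rcases hy with rfl | ⟨p, hp, rfl⟩ <;> rcases hy' with hy' | hy' | hy' | ⟨q, hq, hy'⟩ <;> omega)
    (by
      intro j m₁ m₂ _ h h'
      rw [h' _ (.inl rfl)]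
      exact h)
    (by
      intro j m₁ h1 h2 hm₁
      have hT := le_tRow n j
      have hT' := tRow_add_le_rRow (show j ≤ n by omega) 0
      have hR' := rRow_add_le_of_le (show j ≤ n by omega)
      have hR'' := hR j
      obtain ⟨m₂, hr, hp⟩ := Runs.reduce hk hB (P := lwsProgram) (w := w) (f := 9)
        (x := valueTerm) rfl (by simp [valueTerm, RExp.cost, IExp.cost]) (tb := tRow n j)
        (e₂ := rRow n j) (e₃ := n + 1) (α := n + 1) (β := rRow n j) (Lo := a) (Hi := j + 1)
        (by simp [valueTerm, RExp.reads, IExp.eval]) (by simp [valueTerm, RExp.reads])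
        (by omega) (by omega) (fun p => m (n + 1 + p) + m (rRow n j + p)) m₁
        (by
          intro m₂ hm₂ p h _ hp
          simp only [valueTerm, RExp.eval, IExp.eval, List.getD_cons_zero, List.getD_cons_succ]
          rw [hm₂ (n + 1 + p) (by omega), hm₂ (rRow n j + p) (by omega),
            hm₁ (n + 1 + p) fun hy => by have := hsub _ hy; omega,
            hm₁ (rRow n j + p) fun hy => by have := hsub _ hy; omega])
        (by omega) (L := L) (by omega)
      refine ⟨_, ((hr.call rfl (by simp [IExp.eval, tRowExp, tRow, rRowExp, rRow])
        (by simp [IExp.cost, tRowExp, rRowExp])).seq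
        (Runs.copy (by omega) (a' := j) (b' := tRow n j + a)
          (by simp [IExp.eval]) (by simp [IExp.eval, tRowExp, tRow])
          (by simp [IExp.cost, tRowExp]))).mono ?_ ?_ (by omega) (by omega) (by omega), ?_⟩
      · rintro y (⟨p, h1, h2, rfl | rfl | rfl⟩ | rfl | rfl)
        · exact .inr (.inr (.inr ⟨p, by omega, rfl⟩))
        · exact .inl (by omega)
        · exact .inr (.inl (by omega))
        · exact .inr (.inr (.inr ⟨a, by omega, rfl⟩))
        · exact .inr (.inr (.inl rfl))
      · rintro y (⟨p, h1, h2, rfl⟩ | rfl)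
        · exact .inr ⟨p, by omega, rfl⟩
        · exact .inl rfl
      · simpa using hp)
    (L := L) (by omega)
  refine ⟨m', h.mono ?_ hsub (by omega) (by omega) le_rfl, hp⟩
  have := rRow_add_le_of_le (Nat.zero_le n)
  have : n + 1 ≤ rRow n 0 := Nat.le_mul_of_pos_left _ (by omega)
  rintro y ⟨j, h1, h2, h3 | h3 | h3⟩
  · exact (show y < _ by have := le_tRow n 0; have := tRow_add_le_rRow (Nat.zero_le n) 0; omega)
  · exact h3.2
  · have := hsub y ⟨j, h1, h2, h3⟩
    exact (show y < _ by omega)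

/-! ### The recurrence -/

/-- The solution of the recurrence. -/
noncomputable def lwsSolution (w : ℕ → ℕ → ℝ) (d₀ : ℝ) : ℕ → ℝ
  | 0 => d₀
  | j + 1 => Finset.univ.inf' Finset.univ_nonempty
      fun i : Fin (j + 1) => lwsSolution w d₀ i + w i (j + 1)
decreasing_by exact i.2

theorem isLeast_lwsSolution (w : ℕ → ℕ → ℝ) (d₀ : ℝ) (j : ℕ) (hj : 1 ≤ j) :
    IsLeast {x | ∃ i < j, x = lwsSolution w d₀ i + w i j} (lwsSolution w d₀ j) := by
  obtain ⟨j, rfl⟩ := Nat.exists_eq_add_of_le' hj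
  rw [lwsSolution.eq_2]
  constructor
  · obtain ⟨i, -, hi⟩ := Finset.exists_mem_eq_inf' Finset.univ_nonempty
      fun i : Fin (j + 1) => lwsSolution w d₀ i + w i (j + 1)
    exact ⟨i, i.2, hi⟩
  · rintro x ⟨i, hi, rfl⟩
    exact Finset.inf'_le (fun i : Fin (j + 1) => lwsSolution w d₀ i + w i (j + 1))
      (Finset.mem_univ ⟨i, hi⟩)

/-- An optimal path to `j` enters the block of `j`, which starts at `a`, once. -/
theorem IsRow.isLeast {w : ℕ → ℕ → ℝ} {j a : ℕ} {ρ D E : ℕ → ℝ} (hρ : IsRow w j a ρ) (ha : 1 ≤ a)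
    (haj : a ≤ j) (hD : ∀ i, 1 ≤ i → IsLeast {x | ∃ p < i, x = D p + w p i} (D i))
    (hE : ∀ p, a ≤ p → p ≤ j → IsLeast ((fun i => D i + w i p) '' Set.Ico 0 a) (E p)) :
    IsLeast ((fun p => E p + ρ p) '' Set.Ico a (j + 1)) (D j) := by
  -- Follow a shortest path from `p` to `j`, using the recurrence inequality along each edge.
  have lower : ∀ d p, d = j - p → a ≤ p → p ≤ j → D j ≤ D p + ρ p := by
    intro d
    induction d using Nat.strong_induction_on with
    | _ d ih =>
      intro p hd hp hpj
      rcases hpj.eq_or_lt with rfl | hpj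
      · rw [hρ.1, add_zero]
      · obtain ⟨q, ⟨hq1, hq2⟩, hq⟩ := (hρ.2 p hp hpj).1
        have h1 := ih (j - q) (by omega) q rfl (by omega) (by omega)
        have h2 := (hD q (by omega)).2 ⟨p, by omega, rfl⟩
        simp only at hq
        linarith
  have hDE : ∀ p, a ≤ p → p ≤ j → D p ≤ E p := by
    intro p hp hpj
    obtain ⟨i, ⟨-, hi⟩, h⟩ := (hE p hp hpj).1
    have := (hD p (by omega)).2 ⟨i, by omega, rfl⟩
    simp only at h
    linarith
  -- Go back along optimal predecessors until one lies below `a`; the vertex just after it is the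
  -- entry point `p`.
  have upper : ∀ i, a ≤ i → i ≤ j → ∃ p, a ≤ p ∧ p ≤ i ∧ E p + ρ p ≤ D i + ρ i := by
    intro i
    induction i using Nat.strong_induction_on with
    | _ i ih =>
      intro hi hij
      obtain ⟨p, hp, h⟩ := (hD i (by omega)).1
      rcases lt_or_ge p a with hpa | hpa
      · refine ⟨i, hi, le_rfl, ?_⟩
        have := (hE i hi hij).2 ⟨p, ⟨Nat.zero_le _, hpa⟩, rfl⟩
        simp only at this
        linarith
      · obtain ⟨q, h1, h2, h3⟩ := ih p hp hpa (by omega)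
        refine ⟨q, h1, by omega, ?_⟩
        have := (hρ.2 p hpa (by omega)).2 ⟨i, ⟨by omega, by omega⟩, rfl⟩
        simp only at this
        linarith
  have hlow : ∀ p, a ≤ p → p ≤ j → D j ≤ E p + ρ p := fun p h1 h2 =>
    (lower _ p rfl h1 h2).trans (by linarith [hDE p h1 h2])
  constructor
  · obtain ⟨p, h1, h2, h3⟩ := upper j haj le_rfl
    rw [hρ.1, add_zero] at h3
    exact ⟨p, ⟨h1, by omega⟩, le_antisymm h3 (hlow p h1 h2)⟩
  · rintro x ⟨p, ⟨h1, h2⟩, rfl⟩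
    exact hlow p h1 (by omega)

/-! ### The serial loop over the blocks and the whole program -/

theorem blockStart_eq {s q j : ℕ} (h₁ : 1 + q * s ≤ j) (h₂ : j < 1 + q * s + s) :
    blockStart s j = 1 + q * s := by
  have : (j - 1) / s = q := by
    refine Nat.div_eq_of_lt_le (by omega) ?_
    rw [Nat.succ_mul]
    omega
  rw [blockStart, this]

/-- Loop invariant: `D` is correct before block `q`, and the rows of distances are intact. The
induction variable `G` bounds the number of remaining blocks and thereby the time. -/
theorem runs_blocksBody {k B : ℕ} (hk : 6 ≤ k) (hB : 1 ≤ B) (w : ℕ → ℕ → ℝ) {n s L : ℕ} (hs : 1 ≤ s)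
    (hL : n + 1 ≤ 2 ^ L) {D : ℕ → ℝ}
    (hD : ∀ i, 1 ≤ i → IsLeast {x | ∃ p < i, x = D p + w p i} (D i)) (G : ℕ) :
    ∀ (q : ℕ) (m : ℕ → ℝ), n + 1 - (1 + q * s) ≤ G * s →
      (∀ i, i < 1 + q * s → i ≤ n → m i = D i) →
      (∀ j, j ≤ n → IsRow w j (blockStart s j) fun p => m (rRow n j + p)) →
      ∃ m', Runs k B lwsProgram w blocksBody [1 + q * s, s, n] m m'
        {y | y < (2 * n + 4) * (n + 1)} Set.univ
        ((n + 1 - (1 + q * s)) * (12 * (n + 1) + 14) + 2) (G * (14 + 12 * L) + 2)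
        ((n + 1 - (1 + q * s)) * (36 * (n + 1) + 16 * B)) ∧ ∀ i, i ≤ n → m' i = D i := by
  induction G with
  | zero =>
    intro q m hG hm _
    rw [zero_mul] at hG
    refine ⟨m, (Runs.iteTrue (by simp [IExp.eval]; omega) (by simp [IExp.cost]) Runs.skip).mono
      (fun _ h => h.elim) (fun _ h => h.elim) (by omega) (by omega) (Nat.zero_le _),
      fun i hi => hm i (by omega) hi⟩
  | succ G ih =>
    intro q m hG hm hrow
    obtain ⟨a, ha⟩ : ∃ a, a = 1 + q * s := ⟨_, rfl⟩
    by_cases han : n + 1 ≤ a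
    · refine ⟨m, (Runs.iteTrue (by simp [IExp.eval]; omega) (by simp [IExp.cost]) Runs.skip).mono
        (fun _ h => h.elim) (fun _ h => h.elim) (by omega) (by omega) (Nat.zero_le _),
        fun i hi => hm i (by omega) hi⟩
    -- With truncated subtraction this is the minimum of `a + s` and `n + 1`; the last block may be
    -- shorter.
    obtain ⟨b, hb⟩ : ∃ b, b = a + s - (a + s - (n + 1)) := ⟨_, rfl⟩
    obtain ⟨m₁, hr₁, hp₁⟩ := runs_externalBody hk hB w (n := n) (a := a) (b := b) (by omega)
      (by omega) (by omega) hL m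
    obtain ⟨m₂, hr₂, hp₂⟩ := runs_valuesBody hk hB w (n := n) (a := a) (b := b) (by omega)
      (by omega) hL m₁
    have hR : ∀ j, rRow n 0 ≤ rRow n j := fun j => Nat.mul_le_mul_right _ (by omega)
    have hR0 : 2 * (n + 1) ≤ rRow n 0 := Nat.mul_le_mul_right _ (by omega)
    have hrow₁ : ∀ j p, m₁ (rRow n j + p) = m (rRow n j + p) := fun j p =>
      hr₁.frame _ fun h => by have := hR j; have := h.2; omega
    have hrow₂ : ∀ j p, m₂ (rRow n j + p) = m (rRow n j + p) := fun j p => by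
      rw [← hrow₁]
      exact hr₂.frame _ fun h => by
        have := hR j
        rcases h with h | h <;> omega
    have hval : ∀ j, a ≤ j → j < b → m₂ j = D j := by
      intro j h1 h2
      refine (hp₂ j h1 h2).unique (IsRow.isLeast (w := w) ?_ (by omega) h1 hD fun p h3 h4 => ?_)
      · have := hrow j (by omega)
        rw [blockStart_eq (q := q) (by omega) (by omega), ← ha] at this
        exact this.congr fun p _ _ => hrow₁ j p
      · have := hp₁ p h3 (by omega)
        have e : (fun i => m i + w i p) '' Set.Ico 0 a = (fun i => D i + w i p) '' Set.Ico 0 a :=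
          Set.image_congr fun i hi => by rw [hm i (by have := hi.2; omega) (by have := hi.2; omega)]
        rwa [e] at this
    have hq : 1 + (q + 1) * s = a + s := by rw [Nat.add_mul, ha]; omega
    obtain ⟨m', hr, hp⟩ := ih (q + 1) m₂
      (by rw [Nat.add_mul] at hG; omega)
      (by
        intro i h1 h2
        by_cases h3 : i < a
        · rw [hr₂.frame i fun h => by rcases h with h | h <;> omega,
            hr₁.frame i fun h => by have := h.1; omega]
          exact hm i (by omega) h2
        · exact hval i (by omega) (by omega))
      (fun j hj => (hrow j hj).congr fun p _ _ => hrow₂ j p)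
    refine ⟨m', ?_, hp⟩
    rw [hq] at hr
    rw [← ha]
    refine (Runs.iteFalse (by simp [IExp.eval]; omega) (by simp [IExp.cost])
      ((hr₁.call (args := [.var 0, blockEndExp, .var 2, .var 0, .lit 0]) rfl
        (by simp [IExp.eval, blockEndExp, hb]) (by simp [IExp.cost, blockEndExp])).seq
      ((hr₂.call (args := [.var 0, blockEndExp, .var 2, .var 0, .lit 0]) rfl
        (by simp [IExp.eval, blockEndExp, hb]) (by simp [IExp.cost, blockEndExp])).seq
      (hr.call (args := [.add (.var 0) (.var 1), .var 1, .var 2]) rfl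
        (by simp [IExp.eval]) (by simp [IExp.cost]))))).mono ?_ (fun _ _ => trivial) ?_ ?_ ?_
    · rintro y (h | h | h) <;> exact h
    · have e : n + 1 - a = (b - a) + (n + 1 - (a + s)) := by omega
      have h1 : 1 ≤ b - a := by omega
      rw [e]
      nlinarith
    · rw [Nat.add_mul]
      omega
    · have e : n + 1 - a = (b - a) + (n + 1 - (a + s)) := by omega
      rw [e]
      nlinarith

/-- The size of the blocks: the least positive number whose square is at least `n`. -/
structure IsBlockSize (n s : ℕ) : Prop where
  pos : 1 ≤ s
  le_sq : n ≤ s * s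
  sq_lt : ∀ r, 1 ≤ r → r < s → r * r < n

theorem exists_isBlockSize (n : ℕ) : ∃ s, IsBlockSize n s := by
  have h : ∃ s, 1 ≤ s ∧ n ≤ s * s := ⟨n + 1, by omega, by nlinarith⟩
  classical
  refine ⟨Nat.find h, (Nat.find_spec h).1, (Nat.find_spec h).2, fun r h1 h2 => ?_⟩
  have := Nat.find_min h h2
  simp only [not_and] at this
  exact not_le.1 (this h1)

/-- For `s ≥ 2`, minimality gives (s - 1)² < n, and s ≤ 2(s - 1). -/
theorem IsBlockSize.sq_le {n s : ℕ} (h : IsBlockSize n s) (hn : 1 ≤ n) : s * s ≤ 4 * n := by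
  rcases Nat.lt_or_ge 1 s with h1 | h1
  · have := h.sq_lt (s - 1) (by omega) (by omega)
    obtain ⟨r, rfl⟩ : ∃ r, s = r + 2 := ⟨s - 2, by omega⟩
    simp only [Nat.add_succ_sub_one] at this
    nlinarith
  · have := h.pos
    obtain rfl : s = 1 := by omega
    omega

theorem runs_lwsProgram {k B : ℕ} (hk : 6 ≤ k) (hB : 1 ≤ B) (w : ℕ → ℕ → ℝ) {n s L : ℕ}
    (hs : IsBlockSize n s) (hL : s ≤ 2 ^ L)
    (hL' : n + 1 ≤ 2 ^ L) (m : ℕ → ℝ) :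
    ∃ m', Runs k B lwsProgram w (.call 0 [.lit n]) [] m m' {y | y < (2 * n + 4) * (n + 1)} Set.univ
      ((n + 1) * (6 * (s * s) + 9) + n * (12 * (n + 1) + 14) + 2 * s + 5)
      (s * (22 + 15 * L) + 3 * L + 10)
      ((n + 1) * (26 * (s * s) + 5 * B) + n * (36 * (n + 1) + 16 * B)) ∧
      ∀ i, i ≤ n → m' i = lwsSolution w (m 0) i := by
  obtain ⟨m₁, hr₁, hp₁⟩ := runs_rowsBody hk hB w hs.pos hL hL' m
  -- Since `n ≤ s * s`, at most `s` blocks cover the indices from 1 to `n`.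
  obtain ⟨m₂, hr₂, hp₂⟩ := runs_blocksBody hk hB w hs.pos hL' (isLeast_lwsSolution w (m 0)) s 0 m₁
    (by have := hs.le_sq; omega)
    (by
      intro i hi _
      obtain rfl : i = 0 := by omega
      rw [hr₁.frame 0 fun h => by have := h.1; omega, lwsSolution.eq_1])
    hp₁
  refine ⟨m₂, ?_, hp₂⟩
  -- The block size is found by trying r = 1, 2, ...; each failed trial costs a test and a call, and
  -- `d` trials remain to fail.
  have hroot : ∀ d r, 1 ≤ r → r + d = s →
      Runs k B lwsProgram w rootBody [n, r] m m₂ {y | y < (2 * n + 4) * (n + 1)} Set.univ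
      ((n + 1) * (6 * (s * s) + 9) + n * (12 * (n + 1) + 14) + 2 * d + 5)
      (s * (20 + 15 * L) + 3 * L + 10 + 2 * d)
      ((n + 1) * (26 * (s * s) + 5 * B) + n * (36 * (n + 1) + 16 * B)) := by
    intro d
    induction d with
    | zero =>
      intro r _ hd
      obtain rfl : r = s := by omega
      refine (Runs.iteTrue (by simpa [IExp.eval] using hs.le_sq) (by simp [IExp.cost])
        ((hr₁.call (args := [.lit 0, .add (.var 0) (.lit 1), .var 0, .var 1, .lit 0]) rfl
          (by simp [IExp.eval]) (by simp [IExp.cost])).seq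
        (hr₂.call (args := [.lit 1, .var 1, .var 0]) rfl
          (by simp [IExp.eval]) (by simp [IExp.cost])))).mono ?_ (fun _ _ => trivial) ?_ ?_ ?_
      · rintro y (h | h)
        · exact h.2
        · exact h
      · have e : n + 1 - (1 + 0 * r) = n := by omega
        rw [e]
        omega
      · nlinarith
      · have e : n + 1 - (1 + 0 * r) = n := by omega
        rw [e]
    | succ d ih =>
      intro r hr hd
      refine (Runs.iteFalse (by simpa [IExp.eval] using hs.sq_lt r hr (by omega))
        (by simp [IExp.cost]) ((ih (r + 1) (by omega) (by omega)).call
          (args := [.var 0, .add (.var 1) (.lit 1)]) rfl (by simp [IExp.eval])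
          (by simp [IExp.cost]))).mono (fun _ h => h) (fun _ h => h) (by omega) (by omega) le_rfl
  refine (((hroot (s - 1) 1 le_rfl (by have := hs.pos; omega)).call
    (args := [.var 0, .lit 1]) (env := [n]) rfl (by simp [IExp.eval]) (by simp [IExp.cost])).call
    (f := 0) (args := [.lit n]) (env := []) rfl (by simp [IExp.eval])
    (by simp [IExp.cost])).mono (fun _ h => h) (fun _ h => h) ?_ ?_ le_rfl
  · have := hs.pos
    omega
  · have := hs.pos
    rw [mul_add] at *
    nlinarith [Nat.sub_add_cancel this]

/-! ### Complexity -/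

theorem Runs.of_exec {k B : ℕ} {P : Program} {w : ℕ → ℕ → ℝ} {s : Stmt} {env : List ℕ}
    {m m' m₁ : ℕ → ℝ} {A W : Set ℕ} {c d x : ℕ} {t : SpawnTree}
    (h : Runs k B P w s env m m' A W c d x) (ht : Exec P w s env m t m₁) :
    t.Safe ∧ (∀ y ∈ t.trace, y ∈ A) ∧ t.work ≤ 100 * c ∧ t.span ≤ 100 * d ∧
    ∃ q, B * q ≤ x ∧ SegmentMissesLE k (t.trace.map (· / B)) q := by
  obtain ⟨t', ht', hs, hA, -, hc, hd, hq⟩ := h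
  obtain ⟨rfl, rfl⟩ := ht'.deterministic ht
  exact ⟨hs, hA, hc, hd, hq⟩

theorem SpawnTree.space_le {t : SpawnTree} {S : ℕ} (h : ∀ y ∈ t.trace, y < S) : t.space ≤ S := by
  have key : ∀ l : List ℕ, (∀ y ∈ l, y < S) → (l.map (· + 1)).foldr max 0 ≤ S := by
    intro l
    induction l with
    | nil => simp
    | cons y l ih =>
      intro hl
      exact max_le (hl y List.mem_cons_self) (ih fun z hz => hl z (List.mem_cons_of_mem _ hz))
  exact key _ h

theorem IsBlockSize.le_succ {n s : ℕ} (h : IsBlockSize n s) : s ≤ n + 1 := by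
  by_contra hlt
  have := h.sq_lt (n + 1) (by omega) (by omega)
  nlinarith

/-- Bounds for the program when a cache of `k` lines is large enough for the scans. -/
theorem lwsProgram_bounds {k B : ℕ} (hk : 6 ≤ k) (hB : 1 ≤ B) {w : ℕ → ℕ → ℝ} {n s : ℕ}
    (hs : IsBlockSize n s) {m m' : ℕ → ℝ} {t : SpawnTree}
    (ht : lwsProgram.Run w n m t m') :
    t.Safe ∧ (∀ y ∈ t.trace, y < (2 * n + 4) * (n + 1)) ∧
    t.work ≤ 100 * ((n + 1) * (6 * (s * s) + 9) + n * (12 * (n + 1) + 14) + 2 * s + 5) ∧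
    t.span ≤ 100 * (s * (22 + 15 * (Nat.log 2 n + 1)) + 3 * (Nat.log 2 n + 1) + 10) ∧
    ∃ q, B * q ≤ (n + 1) * (26 * (s * s) + 5 * B) + n * (36 * (n + 1) + 16 * B) ∧
      SegmentMissesLE k (t.trace.map (· / B)) q := by
  have hL : n + 1 ≤ 2 ^ (Nat.log 2 n + 1) := Nat.lt_pow_succ_log_self (by norm_num) n
  obtain ⟨m₁, hr, -⟩ := runs_lwsProgram hk hB w hs (hs.le_succ.trans hL) hL m
  exact hr.of_exec ht

theorem lwsProgram_solves1D : lwsProgram.Solves1D := by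
  intro n
  obtain ⟨s, hs⟩ := exists_isBlockSize n
  refine ⟨fun w m => ?_, fun w m t m' ht => ?_⟩
  · have hL : n + 1 ≤ 2 ^ (Nat.log 2 n + 1) := Nat.lt_pow_succ_log_self (by norm_num) n
    obtain ⟨m', ⟨t, ht, -⟩, hm'⟩ := runs_lwsProgram (k := 6) (B := 1) le_rfl le_rfl w hs (hs.le_succ.trans hL) hL m
    refine ⟨t, m', ht, by rw [hm' 0 (Nat.zero_le _), lwsSolution.eq_1], fun j h1 h2 => ?_⟩
    have e : {x | ∃ i < j, x = m' i + w i j} =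
        {x | ∃ i < j, x = lwsSolution w (m 0) i + w i j} := by
      ext x
      refine exists_congr fun i => and_congr_right fun hi => ?_
      rw [hm' i (by omega)]
    rw [e, hm' j h2]
    exact isLeast_lwsSolution w (m 0) j h1
  · exact (lwsProgram_bounds (k := 6) (B := 1) le_rfl le_rfl hs ht).1.raceFree _

theorem work_lwsProgram_le {w : ℕ → ℕ → ℝ} {n : ℕ} (hn : 2 ≤ n) {m m' : ℕ → ℝ} {t : SpawnTree}
    (ht : lwsProgram.Run w n m t m') : t.work ≤ 12000 * n ^ 2 := by
  obtain ⟨s, hs⟩ := exists_isBlockSize n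
  obtain ⟨-, -, h, -⟩ := lwsProgram_bounds (k := 6) (B := 1) le_rfl le_rfl hs ht
  have h1 := hs.sq_le (by omega)
  have h2 := hs.le_succ
  nlinarith [Nat.mul_le_mul_left (n + 1) h1]

theorem two_mul_add_four_mul_le {n : ℕ} (hn : 2 ≤ n) : (2 * n + 4) * (n + 1) ≤ 8 * n ^ 2 := by
  nlinarith

theorem span_lwsProgram_le {w : ℕ → ℕ → ℝ} {n : ℕ} (hn : 2 ≤ n) {m m' : ℕ → ℝ} {t : SpawnTree}
    (ht : lwsProgram.Run w n m t m') : (t.span : ℝ) ≤ 28000 * (Real.sqrt n * Real.log n) := by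
  obtain ⟨s, hs⟩ := exists_isBlockSize n
  obtain ⟨-, -, -, h, -⟩ := lwsProgram_bounds (k := 6) (B := 1) le_rfl le_rfl hs ht
  have hn' : (2 : ℝ) ≤ n := by exact_mod_cast hn
  have hlog2 : (1 / 2 : ℝ) ≤ Real.log 2 := by linarith [Real.log_two_gt_d9]
  have hlogn : Real.log 2 ≤ Real.log n := Real.log_le_log (by norm_num) hn'
  have hl : (Nat.log 2 n : ℝ) ≤ 2 * Real.log n := by
    have h1 : ((2 : ℝ) ^ Nat.log 2 n) ≤ n := by
      exact_mod_cast Nat.pow_log_le_self 2 (by omega : n ≠ 0)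
    have h2 := Real.log_le_log (by positivity) h1
    rw [Real.log_pow] at h2
    nlinarith [Nat.cast_nonneg (α := ℝ) (Nat.log 2 n)]
  have hsq : (s : ℝ) ≤ 2 * Real.sqrt n := by
    have h1 : ((s : ℝ) * s) ≤ 4 * n := by exact_mod_cast hs.sq_le (by omega)
    have h2 := Real.sq_sqrt (show (0 : ℝ) ≤ n by linarith)
    nlinarith [Real.sqrt_nonneg (n : ℝ)]
  have hs1 : (1 : ℝ) ≤ s := by exact_mod_cast hs.pos
  have h' : (t.span : ℝ) ≤
      100 * (s * (22 + 15 * (Nat.log 2 n + 1)) + 3 * (Nat.log 2 n + 1) + 10) := by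
    exact_mod_cast h
  generalize (Nat.log 2 n : ℝ) = l at *
  -- Constants are absorbed by `1 ≤ s` and `1 / 2 ≤ Real.log n`. Together with `s ≤ 2 * √n` and the
  -- factor 100 this gives 28000.
  have h3 : (s : ℝ) * (22 + 15 * (l + 1)) + 3 * (l + 1) + 10 ≤ s * (140 * Real.log n) := by
    nlinarith
  nlinarith

/-- Three regimes: bounded `B`, memory that fits into the cache, and scanning. The constant is a sum
of terms that cover each of them. -/
theorem cacheMisses_lwsProgram_le {τ : ℝ} (hτ : 0 < τ) {n : ℕ} (hn : 2 ≤ n) {M B : ℕ} (hB : 1 ≤ B)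
    (hBM : B ≤ M) (htall : τ * (B : ℝ) ^ 2 ≤ M) {w : ℕ → ℕ → ℝ} {m m' : ℕ → ℝ} {t : SpawnTree}
    (ht : lwsProgram.Run w n m t m') :
    t.CacheMissesLE M B ((240000 / τ + 104 * (1 + 1 / τ) + 280) * ((n : ℝ) ^ 2 / B + 1)) := by
  have hB0 : (0 : ℝ) < B := by exact_mod_cast hB
  have hk1 : 1 ≤ M / B := (Nat.one_le_div_iff hB).2 hBM
  have hτ' : 0 < 1 / τ := by positivity
  have hτ'' : 240000 / τ = 240000 * (1 / τ) := by ring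
  have hY : 0 ≤ (n : ℝ) ^ 2 / B := by positivity
  have hk : τ * B < (M / B : ℕ) + 1 := by
    have h1 : M < B * (M / B + 1) := Nat.lt_mul_div_succ M hB
    have h2 : (M : ℝ) < B * ((M / B : ℕ) + 1) := by exact_mod_cast h1
    nlinarith
  suffices h : ∃ q : ℕ, SegmentMissesLE (M / B) (t.trace.map (· / B)) q ∧
      (q : ℝ) ≤ (240000 / τ + 104 * (1 + 1 / τ) + 280) * ((n : ℝ) ^ 2 / B + 1) by
    obtain ⟨q, hq, hq'⟩ := h
    obtain ⟨q'', h1, h2⟩ := hq.exists_serves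
    exact ⟨q'', h2, le_trans (by exact_mod_cast h1) hq'⟩
  -- For small `τ * B` the cache may have fewer than six lines. But then n² ≤ (20/τ)(n²/B), so one
  -- miss per access is affordable: 240000 = 12000 · 20.
  rcases le_or_gt (τ * B) 20 with hsmall | hlarge
  · refine ⟨_, .of_length hk1 _, ?_⟩
    rw [List.length_map]
    have h1 : t.trace.length ≤ 12000 * n ^ 2 :=
      (Exec.length_trace_le ht).trans (work_lwsProgram_le hn ht)
    have h2 : (t.trace.length : ℝ) ≤ 12000 * (n : ℝ) ^ 2 := by exact_mod_cast h1
    have h3 : (n : ℝ) ^ 2 ≤ 20 * (1 / τ) * ((n : ℝ) ^ 2 / B) := by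
      rw [mul_one_div, div_mul_div_comm, le_div_iff₀ (by positivity)]
      nlinarith [sq_nonneg (n : ℝ)]
    rw [hτ'']
    nlinarith [mul_nonneg hτ'.le hY]
  obtain ⟨s, hs⟩ := exists_isBlockSize n
  have hk6 : 6 ≤ M / B := by
    have : (19 : ℝ) < (M / B : ℕ) := by linarith
    have : 19 < M / B := by exact_mod_cast this
    omega
  -- In the first case the at most `8 * n ^ 2` cells used occupy at most τB/2 + 2 lines. This is
  -- less than τB - 1, hence below the number of lines in the cache. In the second case `B` is O(n),
  -- so the term `26 * n * B` is O(n²).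
  rcases le_or_gt (16 * (n : ℝ) ^ 2) (τ * (B : ℝ) ^ 2) with hfits | hscan
  · obtain ⟨-, hA, -⟩ := lwsProgram_bounds (k := 6) (B := 1) le_rfl le_rfl hs ht
    have hS := two_mul_add_four_mul_le hn
    have hcard := card_lines_le hB 0 (8 * n ^ 2)
    rw [Nat.sub_zero] at hcard
    have hcard' : ((Finset.Icc (0 / B) (8 * n ^ 2 / B)).card : ℝ) ≤ 8 * ((n : ℝ) ^ 2 / B) + 2 := by
      have h1 : ((8 * n ^ 2 / B : ℕ) : ℝ) ≤ ((8 * n ^ 2 : ℕ) : ℝ) / B := Nat.cast_div_le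
      have h2 : ((Finset.Icc (0 / B) (8 * n ^ 2 / B)).card : ℝ) ≤ (8 * n ^ 2 / B : ℕ) + 2 := by
        exact_mod_cast hcard
      push_cast at h1
      rw [← mul_div_assoc]
      linarith
    refine ⟨_, .of_subset (F := Finset.Icc (0 / B) (8 * n ^ 2 / B)) ?_ ?_, ?_⟩
    · have h1 : (n : ℝ) ^ 2 / B ≤ τ * B / 16 := by
        rw [div_le_iff₀ hB0]
        nlinarith
      have h2 : ((Finset.Icc (0 / B) (8 * n ^ 2 / B)).card : ℝ) < (M / B : ℕ) := by linarith
      exact_mod_cast h2.le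
    · intro y hy
      obtain ⟨z, hz, rfl⟩ := List.mem_map.1 hy
      have := hA z hz
      exact Finset.mem_Icc.2 ⟨Nat.div_le_div_right (Nat.zero_le _), Nat.div_le_div_right (by omega)⟩
    · rw [hτ'']
      nlinarith [mul_nonneg hτ'.le hY]
  · obtain ⟨-, -, -, -, q, hq, hq'⟩ := lwsProgram_bounds hk6 hB hs ht
    refine ⟨q, hq', ?_⟩
    have hBn : (B : ℝ) ≤ 4 * n * (1 + 1 / τ) := by
      have h1 : (B : ℝ) ^ 2 < 16 * (n : ℝ) ^ 2 * (1 / τ) := by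
        rw [mul_one_div, lt_div_iff₀ hτ]
        linarith
      have h2 : (B : ℝ) ^ 2 ≤ (4 * n * (1 + 1 / τ)) ^ 2 := by
        nlinarith [sq_nonneg (n : ℝ), mul_nonneg (sq_nonneg (n : ℝ)) hτ'.le,
          mul_nonneg (sq_nonneg (n : ℝ)) (sq_nonneg (1 / τ))]
      exact le_of_sq_le_sq h2 (by positivity)
    have h1 : B * q ≤ 280 * n ^ 2 + 26 * n * B := by
      have h2 := Nat.mul_le_mul_left (n + 1) (Nat.mul_le_mul_left 26 (hs.sq_le (by omega)))
      nlinarith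
    have h2 : (B : ℝ) * q ≤ 280 * (n : ℝ) ^ 2 + 26 * n * B := by exact_mod_cast h1
    have h3 : (q : ℝ) ≤ (104 * (1 + 1 / τ) + 280) * ((n : ℝ) ^ 2 / B) := by
      rw [← mul_div_assoc, le_div_iff₀ hB0]
      nlinarith [Nat.cast_nonneg (α := ℝ) n]
    rw [hτ'']
    nlinarith [mul_nonneg hτ'.le hY]

end NestedDataflow

open NestedDataflow in
theorem mainTheorem3 :
    ∃ P : Program, P.Solves1D ∧
      -- time, work and space
      (∃ C : ℝ, ∀ (n : ℕ), 2 ≤ n →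
        ∀ (w : ℕ → ℕ → ℝ) (m : ℕ → ℝ) (t : SpawnTree) (m' : ℕ → ℝ), P.Run w n m t m' →
          t.TimeLE P.rules (C * (Real.sqrt n * Real.log n)) ∧
          (t.work : ℝ) ≤ C * (n : ℝ) ^ 2 ∧
          (t.space : ℝ) ≤ C * (n : ℝ) ^ 2) ∧
      -- cache misses, for every tall cache
      (∀ τ : ℝ, 0 < τ → ∃ C : ℝ, ∀ (n : ℕ), 2 ≤ n →
        ∀ (M B : ℕ), 1 ≤ B → B ≤ M → τ * (B : ℝ) ^ 2 ≤ (M : ℝ) →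
        ∀ (w : ℕ → ℕ → ℝ) (m : ℕ → ℝ) (t : SpawnTree) (m' : ℕ → ℝ), P.Run w n m t m' →
          t.CacheMissesLE M B (C * ((n : ℝ) ^ 2 / (B : ℝ) + 1))) ∧
      -- optimality of the work
      (∃ c : ℝ, 0 < c ∧ ∀ (P' : Program) (n : ℕ), P'.Computes1D n →
        ∀ (w : ℕ → ℕ → ℝ) (m : ℕ → ℝ) (t : SpawnTree) (m' : ℕ → ℝ), P'.Run w n m t m' →
          c * (n : ℝ) ^ 2 ≤ (t.work : ℝ)) := by
  refine ⟨lwsProgram, lwsProgram_solves1D, ⟨28000, ?_⟩,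
    fun τ hτ => ⟨_, fun n hn M B hB hBM htall w m t m' ht =>
      cacheMisses_lwsProgram_le hτ hn hB hBM htall ht⟩,
    ⟨1 / 2, by norm_num, ?_⟩⟩
  · intro n hn w m t m' ht
    obtain ⟨s, hs⟩ := exists_isBlockSize n
    refine ⟨fun path hpath => ?_, ?_, ?_⟩
    · exact le_trans (by exact_mod_cast t.sum_costAt_le_span _ path hpath) (span_lwsProgram_le hn ht)
    · have h : (t.work : ℝ) ≤ 12000 * (n : ℝ) ^ 2 := by exact_mod_cast work_lwsProgram_le hn ht
      nlinarith [sq_nonneg (n : ℝ)]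
    · have h1 := (SpawnTree.space_le (lwsProgram_bounds (k := 6) (B := 1) le_rfl le_rfl hs ht).2.1).trans (two_mul_add_four_mul_le hn)
      have h2 : (t.space : ℝ) ≤ 8 * (n : ℝ) ^ 2 := by exact_mod_cast h1
      nlinarith [sq_nonneg (n : ℝ)]
  · intro P' n hP' w m t m' ht
    have h : (n : ℝ) ^ 2 ≤ 2 * t.work := by exact_mod_cast hP'.work_ge ht
    linarith
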